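/- For integers $1\le k\le n$ let $\Theta_k^{\uparrow}\subset\mathbb{R}^n$ be the set of nondecreasing vectors with at most $k$ constant pieces: $\theta\in\Theta_k^{\uparrow}$ if and only if there are integers $0=a_0\le a_1\le\cdots\le a_k=n$ and reals $\mu_1\le\cdots\le\mu_k$ with $\theta_i=\mu_j$ for all integers $a_{j-1}<i\le a_j$ and all $1\le j\le k$. Write $\|\cdot\|$ for the Euclidean norm. Let $\epsilon\in(0,1)$ and $C_1>0$. There is a constant $C>0$, depending only on $\epsilon$ and $C_1$, such that the following holds for all integers $1\le k\le n$, all $\theta^*\in\mathbb{R}^n$ and all $\sigma>0$. Let $X=\theta^*+Z$, where $Z_1,\dots,Z_n$ are independent real random variables with mean zero that satisfy at least one of the following two conditions: (a) $\max_{1\le i\le n}\mathbb{E}|Z_i/\sigma|^{2+\epsilon}\le C_1$ (the $Z_i$ need not be identically distributed); (b) the $Z_i$ are identically distributed and $\mathbb{E}\big[(Z_1^2/\sigma^2)\log(e+Z_1^2/\sigma^2)\big]\le C_1$. Let $\widehat\theta=\widehat\theta(\Theta_k^{\uparrow})$ be the $k$-piece reduced isotonic least-squares estimator, that is, any minimizer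 of $\theta\mapsto\|X-\theta\|^2$ over $\theta\in\Theta_k^{\uparrow}$. Then $$\mathbb{E}\|\widehat\theta-\theta^*\|^2\le C\Big[\inf_{\theta\in\Theta_k^{\uparrow}}\|\theta-\theta^*\|^2+\sigma^2+\sigma^2k\log\log(16n/k)\,\mathbf{1}\{k\ge2\}\Big].$$ -/

import Mathlib

open MeasureTheory ProbabilityTheory

/-- The set `Θ_k^↑` of nondecreasing vectors of `ℝⁿ` with at most `k` constant pieces: there are
`0 = a₀ ≤ a₁ ≤ ⋯ ≤ a_k = n` and `m₁ ≤ ⋯ ≤ m_k` such that `θ_i = m_j` for all integers `i` in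
`(a_{j-1} : a_j]`. Coordinates in this formula are numbered from `1`, those of `Fin n` from `0`, hence
the `i + 1`; the `j`-th piece (`j : Fin k`) runs from `a j.castSucc` to `a j.succ`. -/
def isotonicPieces (n k : ℕ) : Set (EuclideanSpace ℝ (Fin n)) :=
  {θ | ∃ (a : Fin (k + 1) → ℕ) (m : Fin k → ℝ),
    a 0 = 0 ∧ Monotone a ∧ a (Fin.last k) = n ∧ Monotone m ∧
    ∀ (j : Fin k) (i : Fin n),
      (i : ℕ) + 1 ∈ Set.Ioc (a j.castSucc) (a j.succ) → θ i = m j}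

/-- `θ` is a `k`-piece reduced isotonic least-squares fit to the data vector `x`, that is, `θ` is a
minimizer of `η ↦ ‖x - η‖²` over `Θ_k^↑` (minimizers need not be unique). -/
def IsReducedIsotonicLSE {n : ℕ} (k : ℕ) (x θ : EuclideanSpace ℝ (Fin n)) : Prop :=
  θ ∈ isotonicPieces n k ∧
    ∀ η ∈ isotonicPieces n k, ‖x - θ‖ ^ 2 ≤ ‖x - η‖ ^ 2

/-- The moment condition on the errors `Z₁, …, Z_n` at noise level `σ`: either a uniform bound `C₁`
on the `(2 + ε)`-th absolute moments of `Z_i / σ` (no common distribution is needed), or the `Z_i`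
are identically distributed and satisfy an `L log L` bound on `Z_i² / σ²`. -/
def ErrorMomentCondition {Ω : Type*} [MeasurableSpace Ω] (μ : Measure Ω) {n : ℕ}
    (ε C₁ σ : ℝ) (Z : Fin n → Ω → ℝ) : Prop :=
  (∀ i, Integrable (fun ω => |Z i ω / σ| ^ (2 + ε)) μ ∧
      ∫ ω, |Z i ω / σ| ^ (2 + ε) ∂μ ≤ C₁) ∨
  ((∀ i j, IdentDistrib (Z i) (Z j) μ μ) ∧
    ∀ i, Integrable
        (fun ω => (Z i ω ^ 2 / σ ^ 2) * Real.log (Real.exp 1 + Z i ω ^ 2 / σ ^ 2)) μ ∧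
      ∫ ω, (Z i ω ^ 2 / σ ^ 2) * Real.log (Real.exp 1 + Z i ω ^ 2 / σ ^ 2) ∂μ ≤ C₁)

theorem isotonicPieces_nonempty {n k : ℕ} (hk : 1 ≤ k) : (isotonicPieces n k).Nonempty := by
  refine ⟨0, fun j => if j = 0 then 0 else n, fun _ => 0, by simp, ?_, ?_, ?_, by simp⟩
  · intro i j hij
    by_cases hi : i = 0
    · simp [hi]
    · have hj : j ≠ 0 := by
        rintro rfl
        exact hi (Fin.le_zero_iff.mp hij)
      simp [hi, hj]
  · have : Fin.last k ≠ 0 := by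
      intro h
      have := congrArg Fin.val h
      simp at this
      omega
    simp [this]
  · intro i j _
    exact le_rfl

theorem mem_isotonicPieces_iff {n k : ℕ} (hn : 0 < n) (θ : EuclideanSpace ℝ (Fin n)) :
    θ ∈ isotonicPieces n k ↔ ∃ a : Fin (k + 1) → Fin (n + 1),
      (a 0 = 0 ∧ Monotone a ∧ a (Fin.last k) = Fin.last n) ∧ (∀ i i' : Fin n, i ≤ i' → θ i ≤ θ i') ∧
      ∀ (j : Fin k) (i i' : Fin n), (i : ℕ) + 1 ∈ Set.Ioc (a j.castSucc : ℕ) (a j.succ : ℕ) →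
        (i' : ℕ) + 1 ∈ Set.Ioc (a j.castSucc : ℕ) (a j.succ : ℕ) → θ i = θ i' := by
  constructor
  · rintro ⟨a, m, h0, ha, hl, hm, h⟩
    have hle : ∀ j, a j < n + 1 := fun j => by
      have := ha (Fin.le_last j)
      omega
    have hex : ∀ N : ℕ, ∀ hN : N < k + 1, ∀ i : ℕ, i + 1 ≤ a ⟨N, hN⟩ →
        ∃ j : Fin k, i + 1 ∈ Set.Ioc (a j.castSucc) (a j.succ) := by
      intro N
      induction N with
      | zero =>
        intro hN i hi
        have : a ⟨0, hN⟩ = 0 := h0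
        omega
      | succ N ih =>
        intro hN i hi
        by_cases hc : i + 1 ≤ a ⟨N, by omega⟩
        · exact ih _ i hc
        · exact ⟨⟨N, by omega⟩, by simpa using hc, hi⟩
    refine ⟨fun j => ⟨a j, hle j⟩, ⟨Fin.ext h0, fun i j hij => ha hij, Fin.ext hl⟩, ?_, ?_⟩
    · intro i i' hii
      have hki : ∀ i : Fin n, (i : ℕ) + 1 ≤ a ⟨k, by omega⟩ := fun i => by
        have : a ⟨k, by omega⟩ = n := hl
        omega
      obtain ⟨j, hj⟩ := hex k (by omega) i (hki i)
      obtain ⟨j', hj'⟩ := hex k (by omega) i' (hki i')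
      rw [h j i hj, h j' i' hj']
      apply hm
      by_contra hlt
      have h1 : j'.succ ≤ j.castSucc := by
        rw [Fin.le_def]
        simp only [Fin.val_succ, Fin.val_castSucc]
        have := Fin.lt_def.mp (not_le.mp hlt)
        omega
      have h2 := ha h1
      have h3 := hj.1
      have h4 := hj'.2
      have h5 : (i : ℕ) ≤ i' := hii
      omega
    · intro j i i' hi hi'
      rw [h j i hi, h j i' hi']
  · rintro ⟨a, ⟨h0, ha, hl⟩, hθ, h⟩
    have hb : ∀ j, (a j : ℕ) ≤ n := fun j => Nat.lt_succ_iff.mp (a j).2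
    refine ⟨fun j => a j, fun j => θ ⟨(a j.succ : ℕ) - 1, by have := hb j.succ; omega⟩,
      by simp [h0], fun i j hij => ha hij, by simp [hl], ?_, ?_⟩
    · intro j j' hjj
      apply hθ
      have h1 : a j.succ ≤ a j'.succ := ha (Fin.succ_le_succ_iff.mpr hjj)
      have h2 : (a j.succ : ℕ) ≤ a j'.succ := h1
      rw [Fin.le_def]
      simp only
      omega
    · intro j i hi
      apply h j i _ hi
      have h1 : (a j.castSucc : ℕ) < (i : ℕ) + 1 := hi.1
      have h2 : (i : ℕ) + 1 ≤ (a j.succ : ℕ) := hi.2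
      simp only [Set.mem_Ioc]
      omega

theorem isClosed_isotonicPieces {n k : ℕ} (hn : 0 < n) : IsClosed (isotonicPieces n k) := by
  have : isotonicPieces n k = ⋃ a ∈ {a : Fin (k + 1) → Fin (n + 1) |
      a 0 = 0 ∧ Monotone a ∧ a (Fin.last k) = Fin.last n},
      {θ : EuclideanSpace ℝ (Fin n) | (∀ i i' : Fin n, i ≤ i' → θ i ≤ θ i') ∧
      ∀ (j : Fin k) (i i' : Fin n), (i : ℕ) + 1 ∈ Set.Ioc (a j.castSucc : ℕ) (a j.succ : ℕ) →
        (i' : ℕ) + 1 ∈ Set.Ioc (a j.castSucc : ℕ) (a j.succ : ℕ) → θ i = θ i'} := by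
    ext θ
    rw [mem_isotonicPieces_iff hn]
    simp only [Set.mem_iUnion, exists_prop]
    rfl
  rw [this]
  refine Set.Finite.isClosed_biUnion (Set.toFinite _) fun a _ => ?_
  simp only [Set.ofPred_and, Set.ofPred_forall]
  refine IsClosed.inter ?_ ?_
  · refine isClosed_iInter fun i => isClosed_iInter fun i' => isClosed_iInter fun _ => ?_
    exact isClosed_le (by fun_prop) (by fun_prop)
  · refine isClosed_iInter fun j => isClosed_iInter fun i => isClosed_iInter fun i' =>
      isClosed_iInter fun _ => isClosed_iInter fun _ => ?_
    exact isClosed_eq (by fun_prop) (by fun_prop)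

/-- The least-squares problem always has a solution. -/
theorem exists_isReducedIsotonicLSE {n k : ℕ} (hk : 1 ≤ k) (hkn : k ≤ n)
    (x : EuclideanSpace ℝ (Fin n)) : ∃ θ, IsReducedIsotonicLSE k x θ := by
  obtain ⟨θ, hθ, h⟩ := (isClosed_isotonicPieces (k := k) (show 0 < n by omega)).exists_infDist_eq_dist
    (isotonicPieces_nonempty hk) x
  refine ⟨θ, hθ, fun η hη => ?_⟩
  have := Metric.infDist_le_dist_of_mem (x := x) hη
  rw [h, dist_eq_norm, dist_eq_norm] at this
  gcongr

/-! Let `η` be a best approximation of `θstar` in the class. The basic inequality of least squares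
reduces the risk to an integrable bound, uniform over `θ` in the class, on the noise term `2⟨Z, θ -
η⟩` up to a quarter of `‖θ - η‖²`. Both `η` and its blocks are deterministic.

On a block of `η` the difference `θ - η` is monotone. Its positive part decreases when read from the
right end of the block, its negative part when read from the left end. Abel summation turns the
noise against such a part into partial sums of `Z`, started at the end of the block and taken only
where `θ` jumps. Jumps are grouped by dyadic distance from that end. If the normalized squared
partial sums at scale `s` are at most `T + R s`, then `T` is paid only at scales that contain a
jump, hence O(k) times in all, while the excess `R s` may be summed over every scale
(`two_mul_sum_mul_le_of_antitone`, `two_mul_sum_noise_le`).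

The blocks have O(k log(16n/k)) scales altogether (`sum_log_blocks_le`). With `T` of order `τ = log
log (16n/k)`, the exponentially small part of the excess is of order `exp (-τ) = 1 / log (16n/k)`
per scale, so it totals O(k). For this, `exists_dyadic_bound` truncates the squared `i`-th summand
at `(i + 1) / τ`: the bounded part obeys an exponential maximal inequality, and the tails obey
Doob's `L²` inequality. Summed over scales, the tails cost a harmonic sum of truncated second
moments, which either moment condition bounds by a multiple of `τ` (`ErrorMomentCondition.bounds`).

For `k = 1` only the total sum of the noise matters and no iterated logarithm appears. -/

/-! ### Deterministic bounds for monotone weights against noise. -/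

/-- Abel summation. -/
theorem sum_mul_eq_sum_sub_mul_partialSum (z v : ℕ → ℝ) (m : ℕ) :
    ∑ r ∈ Finset.range m, z r * v r =
      v m * ∑ i ∈ Finset.range m, z i +
        ∑ r ∈ Finset.range m, (v r - v (r + 1)) * ∑ i ∈ Finset.range (r + 1), z i := by
  induction m with
  | zero => simp
  | succ m ih =>
    rw [Finset.sum_range_succ, ih,
      Finset.sum_range_succ (fun r => (v r - v (r + 1)) * ∑ i ∈ Finset.range (r + 1), z i) m,
      Finset.sum_range_succ z m]
    ring

/-- Cauchy condensation: the term at scale `s ≥ 1` is at most twice the sum of squares over `[2 ^ (s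
- 1), 2 ^ s)`, where `v` is still at least `v (2 ^ s - 1)`. -/
theorem sum_two_pow_mul_sq_le {v : ℕ → ℝ} (hv : Antitone v) (hv0 : ∀ r, 0 ≤ v r) (L : ℕ) :
    ∑ s ∈ Finset.range (L + 1), (2 : ℝ) ^ s * v (2 ^ s - 1) ^ 2 ≤
      2 * ∑ r ∈ Finset.range (2 ^ L), v r ^ 2 := by
  induction L with
  | zero => simp; nlinarith [sq_nonneg (v 0)]
  | succ L ih =>
    rw [Finset.sum_range_succ]
    have hpow : 2 ^ L ≤ 2 ^ (L + 1) := Nat.pow_le_pow_right (by norm_num) (by omega)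
    have h1 : ∑ r ∈ Finset.range (2 ^ (L + 1)), v r ^ 2 =
        ∑ r ∈ Finset.range (2 ^ L), v r ^ 2 + ∑ r ∈ Finset.Ico (2 ^ L) (2 ^ (L + 1)), v r ^ 2 :=
      (Finset.sum_range_add_sum_Ico _ hpow).symm
    have h2 : (Finset.Ico (2 ^ L) (2 ^ (L + 1))).card • v (2 ^ (L + 1) - 1) ^ 2 ≤
        ∑ r ∈ Finset.Ico (2 ^ L) (2 ^ (L + 1)), v r ^ 2 := by
      refine Finset.card_nsmul_le_sum _ _ _ fun r hr => ?_
      rw [Finset.mem_Ico] at hr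
      exact pow_le_pow_left₀ (hv0 _) (hv (by omega)) 2
    have h3 : 2 ^ (L + 1) - 2 ^ L = 2 ^ L := by rw [pow_succ]; omega
    rw [Nat.card_Ico, h3, nsmul_eq_mul] at h2
    push_cast at h2
    rw [h1, pow_succ]
    linarith

/-- A nonincreasing weighted sum is controlled by dyadic maxima of the partial sums, at the scales
at which the weights jump. -/
theorem two_mul_sum_mul_le_of_antitone {v z R : ℕ → ℝ} {m : ℕ} {T : ℝ} (hv : Antitone v)
    (hvm : ∀ r, m ≤ r → v r = 0) (hT : 0 ≤ T) (hR : ∀ s, 0 ≤ R s)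
    (hS : ∀ r < m, (∑ i ∈ Finset.range (r + 1), z i) ^ 2 ≤
      (T + R (Nat.log 2 (r + 1))) * 2 ^ Nat.log 2 (r + 1)) :
    2 * ∑ r ∈ Finset.range m, z r * v r ≤
      8 * T * ((Finset.range m).filter fun r => v r ≠ v (r + 1)).card +
        8 * ∑ s ∈ Finset.range (Nat.log 2 m + 1), R s +
          1 / 4 * ∑ r ∈ Finset.range m, v r ^ 2 := by
  classical
  have hv0 : ∀ r, 0 ≤ v r := fun r => by
    have := hv (le_max_left r m)
    rwa [hvm _ (le_max_right r m)] at this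
  set J := (Finset.range m).filter fun r => v r ≠ v (r + 1) with hJ
  set ℓ : ℕ → ℕ := fun r => Nat.log 2 (r + 1) with hℓ
  set A := J.image ℓ with hA
  set b : ℕ → ℝ := fun s => Real.sqrt ((T + R s) * 2 ^ s) with hb
  have hTR : ∀ s, 0 ≤ T + R s := fun s => add_nonneg hT (hR s)
  have h1 : ∑ r ∈ Finset.range m, z r * v r =
      ∑ r ∈ J, (v r - v (r + 1)) * ∑ i ∈ Finset.range (r + 1), z i := by
    rw [sum_mul_eq_sum_sub_mul_partialSum, hvm m le_rfl, zero_mul, zero_add, hJ,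
      Finset.sum_filter_of_ne]
    intro r _ hr hvr
    exact hr (by rw [hvr]; simp)
  have h2 : ∑ r ∈ J, (v r - v (r + 1)) * ∑ i ∈ Finset.range (r + 1), z i ≤
      ∑ r ∈ J, (v r - v (r + 1)) * b (ℓ r) := by
    refine Finset.sum_le_sum fun r hr => ?_
    have hrm : r < m := by simpa using (Finset.mem_filter.mp hr).1
    refine mul_le_mul_of_nonneg_left ?_ (sub_nonneg.mpr (hv (Nat.le_succ r)))
    exact Real.le_sqrt_of_sq_le (hS r hrm)
  have h3 : ∑ r ∈ J, (v r - v (r + 1)) * b (ℓ r) =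
      ∑ s ∈ A, ∑ r ∈ J with ℓ r = s, (v r - v (r + 1)) * b (ℓ r) :=
    (Finset.sum_fiberwise_of_maps_to (fun r hr => Finset.mem_image_of_mem _ hr) _).symm
  -- Scale `s` consists of the `r` with `2 ^ s - 1 ≤ r < 2 ^ (s + 1) - 1`, over which the decrements
  -- telescope.
  have h4 : ∀ s, ∑ r ∈ J with ℓ r = s, (v r - v (r + 1)) * b (ℓ r) ≤ b s * v (2 ^ s - 1) := by
    intro s
    have hpow : 2 ^ s - 1 ≤ 2 ^ (s + 1) - 1 :=
      Nat.sub_le_sub_right (Nat.pow_le_pow_right (by norm_num) (by omega)) 1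
    have h5 : ∑ r ∈ J with ℓ r = s, (v r - v (r + 1)) * b (ℓ r) =
        b s * ∑ r ∈ J with ℓ r = s, (v r - v (r + 1)) := by
      rw [Finset.mul_sum]
      refine Finset.sum_congr rfl fun r hr => ?_
      rw [(Finset.mem_filter.mp hr).2, mul_comm]
    rw [h5]
    refine mul_le_mul_of_nonneg_left ?_ (Real.sqrt_nonneg _)
    calc ∑ r ∈ J with ℓ r = s, (v r - v (r + 1))
        ≤ ∑ r ∈ Finset.Ico (2 ^ s - 1) (2 ^ (s + 1) - 1), (v r - v (r + 1)) := by
          refine Finset.sum_le_sum_of_subset_of_nonneg ?_ fun r _ _ =>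
            sub_nonneg.mpr (hv (Nat.le_succ r))
          intro r hr
          have h6 : Nat.log 2 (r + 1) = s := (Finset.mem_filter.mp hr).2
          have h7 := Nat.pow_log_le_self 2 (Nat.succ_ne_zero r)
          have h8 := Nat.lt_pow_succ_log_self (b := 2) (by norm_num) (r + 1)
          rw [Nat.succ_eq_add_one, h6] at h7
          rw [h6] at h8
          rw [Finset.mem_Ico]
          omega
      _ = v (2 ^ s - 1) - v (2 ^ (s + 1) - 1) := by
          rw [← neg_inj, ← Finset.sum_neg_distrib, neg_sub, ← Finset.sum_Ico_sub v hpow]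
          simp only [neg_sub]
      _ ≤ v (2 ^ s - 1) := by linarith [hv0 (2 ^ (s + 1) - 1)]
  -- Weighted AM-GM; condensation doubles the `1 / 8` to the final `1 / 4`.
  have h5 : ∀ s, 2 * (b s * v (2 ^ s - 1)) ≤
      8 * (T + R s) + 1 / 8 * ((2 : ℝ) ^ s * v (2 ^ s - 1) ^ 2) := by
    intro s
    have e1 : b s = Real.sqrt (T + R s) * Real.sqrt (2 ^ s) := Real.sqrt_mul (hTR s) _
    have e2 := Real.sq_sqrt (hTR s)
    have e3 := Real.sq_sqrt (show (0 : ℝ) ≤ 2 ^ s by positivity)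
    rw [e1]
    nlinarith [sq_nonneg (8 * Real.sqrt (T + R s) - Real.sqrt (2 ^ s) * v (2 ^ s - 1))]
  have hAr : A ⊆ Finset.range (Nat.log 2 m + 1) := by
    intro s hs
    obtain ⟨r, hr, rfl⟩ := Finset.mem_image.mp hs
    have hrm : r < m := by simpa using (Finset.mem_filter.mp hr).1
    rw [Finset.mem_range, Nat.lt_succ_iff]
    exact Nat.log_mono_right hrm
  have h6 : ∑ s ∈ A, (2 : ℝ) ^ s * v (2 ^ s - 1) ^ 2 ≤ 2 * ∑ r ∈ Finset.range m, v r ^ 2 := by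
    calc ∑ s ∈ A, (2 : ℝ) ^ s * v (2 ^ s - 1) ^ 2
        ≤ ∑ s ∈ Finset.range (Nat.log 2 m + 1), (2 : ℝ) ^ s * v (2 ^ s - 1) ^ 2 :=
          Finset.sum_le_sum_of_subset_of_nonneg hAr fun _ _ _ => by positivity
      _ ≤ 2 * ∑ r ∈ Finset.range (2 ^ Nat.log 2 m), v r ^ 2 := sum_two_pow_mul_sq_le hv hv0 _
      _ ≤ 2 * ∑ r ∈ Finset.range m, v r ^ 2 := by
          refine mul_le_mul_of_nonneg_left ?_ (by norm_num)
          rw [← Finset.sum_filter_add_sum_filter_not _ (fun r => r < m),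
            Finset.sum_eq_zero (s := Finset.filter (fun r => ¬ r < m) _), add_zero]
          · refine Finset.sum_le_sum_of_subset_of_nonneg ?_ fun _ _ _ => sq_nonneg _
            intro r hr
            simpa using (Finset.mem_filter.mp hr).2
          · intro r hr
            rw [hvm r (not_lt.mp (Finset.mem_filter.mp hr).2)]
            norm_num
  have h7 : ∑ s ∈ A, R s ≤ ∑ s ∈ Finset.range (Nat.log 2 m + 1), R s :=
    Finset.sum_le_sum_of_subset_of_nonneg hAr fun _ _ _ => hR _
  -- Scales that contain a jump are no more numerous than jumps, so `T` is charged per jump and not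
  -- per scale.
  have h8 : (A.card : ℝ) ≤ J.card := by exact_mod_cast Finset.card_image_le
  calc 2 * ∑ r ∈ Finset.range m, z r * v r
      ≤ 2 * ∑ s ∈ A, b s * v (2 ^ s - 1) := by
        rw [h1]
        refine mul_le_mul_of_nonneg_left (h2.trans ?_) (by norm_num)
        rw [h3]
        exact Finset.sum_le_sum fun s _ => h4 s
    _ ≤ ∑ s ∈ A, (8 * (T + R s) + 1 / 8 * ((2 : ℝ) ^ s * v (2 ^ s - 1) ^ 2)) := by
        rw [Finset.mul_sum]
        exact Finset.sum_le_sum fun s _ => h5 s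
    _ = 8 * T * A.card + 8 * ∑ s ∈ A, R s + 1 / 8 * ∑ s ∈ A, (2 : ℝ) ^ s * v (2 ^ s - 1) ^ 2 := by
        simp only [Finset.sum_add_distrib, ← Finset.mul_sum, Finset.sum_const, nsmul_eq_mul]
        ring
    _ ≤ _ := by
        have := mul_le_mul_of_nonneg_left h8 (show 0 ≤ 8 * T by positivity)
        linarith

/-- A monotone sequence on the block `[p, q)` against noise: its positive part is read from the right
end of the block and its negative part from the left end. -/
theorem two_mul_sum_Ico_mul_le_of_monotoneOn {w : ℕ → ℝ} {z : ℤ → ℝ} {R R' : ℕ → ℝ} {p q : ℕ} {T : ℝ}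
    (hw : ∀ i j, p ≤ i → i ≤ j → j < q → w i ≤ w j) (hT : 0 ≤ T)
    (hR : ∀ s, 0 ≤ R s) (hR' : ∀ s, 0 ≤ R' s)
    (hS : ∀ r < q - p, (∑ i ∈ Finset.range (r + 1), z (p + i)) ^ 2 ≤
      (T + R (Nat.log 2 (r + 1))) * 2 ^ Nat.log 2 (r + 1))
    (hS' : ∀ r < q - p, (∑ i ∈ Finset.range (r + 1), z (q - 1 - i)) ^ 2 ≤
      (T + R' (Nat.log 2 (r + 1))) * 2 ^ Nat.log 2 (r + 1)) :
    2 * ∑ i ∈ Finset.Ico p q, z i * w i ≤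
      16 * T * (1 + ((Finset.Ico p q).filter fun i => i + 1 < q ∧ w i ≠ w (i + 1)).card) +
        8 * (∑ s ∈ Finset.range (Nat.log 2 (q - p) + 1), R s +
          ∑ s ∈ Finset.range (Nat.log 2 (q - p) + 1), R' s) +
          1 / 4 * ∑ i ∈ Finset.Ico p q, w i ^ 2 := by
  classical
  set m := q - p with hm
  set J := (Finset.Ico p q).filter fun i => i + 1 < q ∧ w i ≠ w (i + 1) with hJ
  set u : ℕ → ℝ := fun r => if r < m then max (-w (p + r)) 0 else 0 with hu
  set v : ℕ → ℝ := fun r => if r < m then max (w (q - 1 - r)) 0 else 0 with hv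
  have hua : Antitone u := by
    intro r r' hr
    simp only [hu]
    split_ifs with h1 h2 h2
    · exact max_le_max_right 0 (neg_le_neg (hw _ _ (by omega) (by omega) (by omega)))
    · omega
    · exact le_max_right _ _
    · exact le_rfl
  have hva : Antitone v := by
    intro r r' hr
    simp only [hv]
    split_ifs with h1 h2 h2
    · exact max_le_max_right 0 (hw _ _ (by omega) (by omega) (by omega))
    · omega
    · exact le_max_right _ _
    · exact le_rfl
  have hum : ∀ r, m ≤ r → u r = 0 := fun r hr => by simp [hu, not_lt.mpr hr]
  have hvm : ∀ r, m ≤ r → v r = 0 := fun r hr => by simp [hv, not_lt.mpr hr]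
  -- The `1` accounts for the drop to the value `0` past the last index `m - 1`.
  have hju : (((Finset.range m).filter fun r => u r ≠ u (r + 1)).card : ℝ) ≤ 1 + J.card := by
    have : ((Finset.range m).filter fun r => u r ≠ u (r + 1)) ⊆
        insert (m - 1) (J.image fun i => i - p) := by
      intro r hr
      rw [Finset.mem_filter, Finset.mem_range] at hr
      rw [Finset.mem_insert, Finset.mem_image]
      by_cases h : r + 1 < m
      · right
        refine ⟨p + r, ?_, by omega⟩
        rw [hJ, Finset.mem_filter, Finset.mem_Ico]
        refine ⟨by omega, by omega, fun h' => hr.2 ?_⟩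
        simp only [hu, hr.1, h, if_true, h', ← add_assoc]
      · left; omega
    have h1 := (Finset.card_le_card this).trans (Finset.card_insert_le _ _)
    have h2 : (J.image fun i => i - p).card ≤ J.card := Finset.card_image_le
    have h3 : ((Finset.range m).filter fun r => u r ≠ u (r + 1)).card ≤ 1 + J.card := by omega
    exact_mod_cast h3
  have hjv : (((Finset.range m).filter fun r => v r ≠ v (r + 1)).card : ℝ) ≤ 1 + J.card := by
    have : ((Finset.range m).filter fun r => v r ≠ v (r + 1)) ⊆
        insert (m - 1) (J.image fun i => q - 2 - i) := by
      intro r hr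
      rw [Finset.mem_filter, Finset.mem_range] at hr
      rw [Finset.mem_insert, Finset.mem_image]
      by_cases h : r + 1 < m
      · right
        refine ⟨q - 1 - (r + 1), ?_, by omega⟩
        rw [hJ, Finset.mem_filter, Finset.mem_Ico]
        refine ⟨by omega, by omega, fun h' => hr.2 ?_⟩
        rw [show q - 1 - (r + 1) + 1 = q - 1 - r by omega] at h'
        simp only [hv, hr.1, h, if_true, h']
      · left; omega
    have h1 := (Finset.card_le_card this).trans (Finset.card_insert_le _ _)
    have h2 : (J.image fun i => q - 2 - i).card ≤ J.card := Finset.card_image_le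
    have h3 : ((Finset.range m).filter fun r => v r ≠ v (r + 1)).card ≤ 1 + J.card := by omega
    exact_mod_cast h3
  have hL : ∀ f : ℕ → ℝ, ∑ i ∈ Finset.Ico p q, f i = ∑ r ∈ Finset.range m, f (p + r) :=
    fun f => Finset.sum_Ico_eq_sum_range f p q
  have hRt : ∀ f : ℕ → ℝ, ∑ i ∈ Finset.Ico p q, f i = ∑ r ∈ Finset.range m, f (q - 1 - r) := by
    intro f
    rw [hL, ← Finset.sum_range_reflect]
    refine Finset.sum_congr rfl fun r hr => ?_
    rw [Finset.mem_range] at hr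
    congr 1
    omega
  have hsplit : ∑ i ∈ Finset.Ico p q, z i * w i =
      ∑ r ∈ Finset.range m, z (q - 1 - r) * v r + ∑ r ∈ Finset.range m, -z (p + r) * u r := by
    have e1 : ∑ r ∈ Finset.range m, z (q - 1 - r) * v r =
        ∑ i ∈ Finset.Ico p q, z i * max (w i) 0 := by
      rw [hRt]
      refine Finset.sum_congr rfl fun r hr => ?_
      rw [Finset.mem_range] at hr
      simp only [hv, hr, if_true]
      congr 2
      omega
    have e2 : ∑ r ∈ Finset.range m, -z (p + r) * u r =
        ∑ i ∈ Finset.Ico p q, -z i * max (-w i) 0 := by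
      rw [hL]
      refine Finset.sum_congr rfl fun r hr => ?_
      rw [Finset.mem_range] at hr
      simp only [hu, hr, if_true]
      push_cast
      rfl
    rw [e1, e2, ← Finset.sum_add_distrib]
    refine Finset.sum_congr rfl fun i _ => ?_
    have : w i = max (w i) 0 - max (-w i) 0 := by
      rcases le_total 0 (w i) with h | h
      · rw [max_eq_left h, max_eq_right (by linarith)]; ring
      · rw [max_eq_right h, max_eq_left (by linarith)]; ring
    nth_rewrite 1 [this]
    ring
  have hsq : ∑ r ∈ Finset.range m, v r ^ 2 + ∑ r ∈ Finset.range m, u r ^ 2 =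
      ∑ i ∈ Finset.Ico p q, w i ^ 2 := by
    have e1 : ∑ r ∈ Finset.range m, v r ^ 2 = ∑ i ∈ Finset.Ico p q, max (w i) 0 ^ 2 := by
      rw [hRt]
      refine Finset.sum_congr rfl fun r hr => ?_
      rw [Finset.mem_range] at hr
      simp only [hv, hr, if_true]
    have e2 : ∑ r ∈ Finset.range m, u r ^ 2 = ∑ i ∈ Finset.Ico p q, max (-w i) 0 ^ 2 := by
      rw [hL]
      refine Finset.sum_congr rfl fun r hr => ?_
      rw [Finset.mem_range] at hr
      simp only [hu, hr, if_true]
    rw [e1, e2, ← Finset.sum_add_distrib]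
    refine Finset.sum_congr rfl fun i _ => ?_
    rcases le_total 0 (w i) with h | h
    · rw [max_eq_left h, max_eq_right (by linarith)]; ring
    · rw [max_eq_right h, max_eq_left (by linarith)]; ring
  have h1 := two_mul_sum_mul_le_of_antitone (z := fun r => z (q - 1 - r)) hva hvm hT hR' hS'
  have h2 := two_mul_sum_mul_le_of_antitone (z := fun r => -z (p + r)) hua hum hT hR
    (fun r hr => by rw [Finset.sum_neg_distrib, neg_sq]; exact hS r hr)
  have h3 := mul_le_mul_of_nonneg_left hju (show 0 ≤ 8 * T by positivity)
  have h4 := mul_le_mul_of_nonneg_left hjv (show 0 ≤ 8 * T by positivity)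
  rw [hsplit, ← hsq]
  linarith

/-! ### Maximal inequalities for random walks. -/

/-- Pathwise form of Doob's `L²` maximal inequality. -/
theorem sq_partialSups_le (f : ℕ → ℝ) (n : ℕ) :
    partialSups f n ^ 2 ≤
      4 * f n ^ 2 - 4 * ∑ i ∈ Finset.range n, partialSups f i * (f (i + 1) - f i) := by
  -- The running maximum changes only at times when it equals `f`. The lemma then follows from `M f
  -- ≤ M² / 4 + f²`.
  have key : ∑ i ∈ Finset.range n, partialSups f i * (f (i + 1) - f i) ≤
      partialSups f n * f n - partialSups f n ^ 2 / 2 := by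
    induction n with
    | zero => simp; nlinarith [sq_nonneg (f 0)]
    | succ n ih =>
      rw [Finset.sum_range_succ, partialSups_add_one]
      rcases le_total (partialSups f n) (f (n + 1)) with h | h
      · rw [sup_eq_right.mpr h]
        nlinarith [sq_nonneg (f (n + 1) - partialSups f n)]
      · rw [sup_eq_left.mpr h]
        linarith
  nlinarith [sq_nonneg (partialSups f n / 2 - f n)]

theorem measurable_partialSups {Ω : Type*} {m : MeasurableSpace Ω} {f : ℕ → Ω → ℝ} {n : ℕ}
    (hf : ∀ i ≤ n, Measurable (f i)) : Measurable fun ω => partialSups (fun i => f i ω) n := by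
  induction n with
  | zero => simpa using hf 0 le_rfl
  | succ n ih =>
    simp only [partialSups_add_one]
    exact (ih fun i hi => hf i (by omega)).sup (hf _ le_rfl)

section Maximal

variable {Ω : Type*} [MeasurableSpace Ω] {μ : Measure Ω}

/-- A variable of the past is uncorrelated with the next centered independent variable. -/
theorem integral_mul_eq_zero_of_iIndepFun {Y : ℕ → Ω → ℝ} (hY : ∀ i, Measurable (Y i))
    (hind : iIndepFun Y μ) (h0 : ∀ i, ∫ ω, Y i ω ∂μ = 0) (hint : ∀ i, Integrable (Y i) μ)
    {n : ℕ} {X : Ω → ℝ} (hXi : Integrable X μ)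
    (hX : Measurable[⨆ j ∈ Set.Iio n, MeasurableSpace.comap (Y j) inferInstance] X) :
    Integrable (fun ω => X ω * Y n ω) μ ∧ ∫ ω, X ω * Y n ω ∂μ = 0 := by
  have h1 : Indep (⨆ j ∈ Set.Iio n, MeasurableSpace.comap (Y j) inferInstance)
      (⨆ j ∈ ({n} : Set ℕ), MeasurableSpace.comap (Y j) inferInstance) μ :=
    indep_iSup_of_disjoint (fun i => (hY i).comap_le) hind (by simp)
  have h2 : IndepFun X (Y n) μ := by
    rw [IndepFun_iff_Indep]
    simp only [Set.mem_singleton_iff, iSup_iSup_eq_left] at h1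
    exact indep_of_indep_of_le_left h1 hX.comap_le
  refine ⟨h2.integrable_mul hXi (hint n), ?_⟩
  have := h2.integral_mul_eq_mul_integral hXi.aestronglyMeasurable (hint n).aestronglyMeasurable
  simpa [h0 n] using this

/-- Doob's `L²` inequality for a nonnegative convex function of a random walk; `g'` is a
subgradient of `g`. -/
theorem integral_sq_partialSups_le [IsFiniteMeasure μ] {Y : ℕ → Ω → ℝ}
    (hY : ∀ i, Measurable (Y i))
    (hind : iIndepFun Y μ) (h0 : ∀ i, ∫ ω, Y i ω ∂μ = 0) (hint : ∀ i, Integrable (Y i) μ)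
    {g g' : ℝ → ℝ} (hg : Measurable g) (hg' : Measurable g') (hg0 : ∀ x, 0 ≤ g x)
    (hsub : ∀ x y, g x + g' x * y ≤ g (x + y))
    (hgL : ∀ n, MemLp (fun ω => g (∑ i ∈ Finset.range n, Y i ω)) 2 μ)
    (hgL' : ∀ n, MemLp (fun ω => g' (∑ i ∈ Finset.range n, Y i ω)) 2 μ) (n : ℕ) :
    Integrable (fun ω => partialSups (fun j => g (∑ i ∈ Finset.range j, Y i ω)) n ^ 2) μ ∧
      ∫ ω, partialSups (fun j => g (∑ i ∈ Finset.range j, Y i ω)) n ^ 2 ∂μ ≤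
        4 * ∫ ω, g (∑ i ∈ Finset.range n, Y i ω) ^ 2 ∂μ := by
  set S : ℕ → Ω → ℝ := fun j ω => ∑ i ∈ Finset.range j, Y i ω with hS
  set M : ℕ → Ω → ℝ := fun n ω => partialSups (fun j => g (S j ω)) n with hM
  have hSm : ∀ i j, j ≤ i →
      Measurable[⨆ j ∈ Set.Iio i, MeasurableSpace.comap (Y j) inferInstance] (S j) := by
    intro i j hj
    refine Finset.measurable_fun_sum _ fun l hl => ?_
    rw [Finset.mem_range] at hl
    have h1 : Measurable[MeasurableSpace.comap (Y l) inferInstance] (Y l) := comap_measurable _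
    exact h1.mono (le_iSup₂_of_le l (Set.mem_Iio.mpr (by omega)) le_rfl) le_rfl
  have hMm : ∀ i,
      Measurable[⨆ j ∈ Set.Iio i, MeasurableSpace.comap (Y j) inferInstance] (M i) :=
    fun i => measurable_partialSups fun j hj => hg.comp (hSm i j hj)
  have hle : ∀ i, (⨆ j ∈ Set.Iio i, MeasurableSpace.comap (Y j) inferInstance) ≤ ‹MeasurableSpace Ω› :=
    fun i => iSup₂_le fun j _ => (hY j).comap_le
  have hM0 : ∀ i ω, 0 ≤ M i ω := fun i ω =>
    (hg0 _).trans (le_partialSups_of_le (fun j => g (S j ω)) (Nat.zero_le i))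
  have hML : ∀ n, MemLp (M n) 2 μ := by
    intro n
    induction n with
    | zero => simpa only [hM, partialSups_zero] using hgL 0
    | succ n ih =>
      have := ih.sup (hgL (n + 1))
      simp only [hM, partialSups_add_one]
      exact this
  have hterm : ∀ i, Integrable (fun ω => M i ω * g' (S i ω) * Y i ω) μ ∧
      ∫ ω, M i ω * g' (S i ω) * Y i ω ∂μ = 0 := fun i =>
    integral_mul_eq_zero_of_iIndepFun hY hind h0 hint ((hML i).integrable_mul (hgL' i))
      ((hMm i).mul (hg'.comp (hSm i i le_rfl)))
  -- The subgradient replaces the increment of `g` by `g' (S i) * Y i`; its factor `M i * g' (S i)`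
  -- depends only on the past, so the sum has mean zero.
  have hpath : ∀ ω, M n ω ^ 2 ≤
      4 * g (S n ω) ^ 2 - 4 * ∑ i ∈ Finset.range n, M i ω * g' (S i ω) * Y i ω := by
    intro ω
    refine (sq_partialSups_le (fun j => g (S j ω)) n).trans ?_
    refine sub_le_sub_left (mul_le_mul_of_nonneg_left ?_ (by norm_num)) _
    refine Finset.sum_le_sum fun i _ => ?_
    rw [mul_assoc]
    refine mul_le_mul_of_nonneg_left ?_ (hM0 i ω)
    have := hsub (S i ω) (Y i ω)
    have h1 : S (i + 1) ω = S i ω + Y i ω := Finset.sum_range_succ _ _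
    rw [h1]
    linarith
  refine ⟨(hML n).integrable_sq, ?_⟩
  have hi1 : Integrable (fun ω => 4 * g (S n ω) ^ 2) μ := (hgL n).integrable_sq.const_mul 4
  have hi2 : Integrable (fun ω => 4 * ∑ i ∈ Finset.range n, M i ω * g' (S i ω) * Y i ω) μ :=
    (integrable_finsetSum _ fun i _ => (hterm i).1).const_mul 4
  calc ∫ ω, M n ω ^ 2 ∂μ
      ≤ ∫ ω, (4 * g (S n ω) ^ 2 - 4 * ∑ i ∈ Finset.range n, M i ω * g' (S i ω) * Y i ω) ∂μ :=
        integral_mono (hML n).integrable_sq (hi1.sub hi2) hpath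
    _ = 4 * ∫ ω, g (S n ω) ^ 2 ∂μ := by
        rw [integral_sub hi1 hi2, integral_const_mul, integral_const_mul,
          integral_finsetSum _ fun i _ => (hterm i).1]
        simp [fun i => (hterm i).2]

theorem integral_sq_sum_range [IsProbabilityMeasure μ] {Y : ℕ → Ω → ℝ}
    (hind : iIndepFun Y μ) (h0 : ∀ i, ∫ ω, Y i ω ∂μ = 0) (hL : ∀ i, MemLp (Y i) 2 μ) (n : ℕ) :
    ∫ ω, (∑ i ∈ Finset.range n, Y i ω) ^ 2 ∂μ = ∑ i ∈ Finset.range n, ∫ ω, Y i ω ^ 2 ∂μ := by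
  have h1 := IndepFun.variance_sum (s := Finset.range n) (fun i _ => hL i)
    (fun i _ j _ hij => hind.indepFun hij)
  have h2 : (∑ i ∈ Finset.range n, Y i) = fun ω => ∑ i ∈ Finset.range n, Y i ω := by
    ext ω; simp
  rw [variance_of_integral_eq_zero, h2] at h1
  · rw [h1]
    refine Finset.sum_congr rfl fun i _ => ?_
    exact variance_of_integral_eq_zero (hL i).1.aemeasurable (h0 i)
  · exact Finset.aemeasurable_sum _ fun i _ => (hL i).1.aemeasurable
  · rw [h2, integral_finsetSum _ fun i _ => (hL i).integrable (by norm_num)]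
    simp [h0]

/-- Doob's inequality for `g = |·|`, with the sign as subgradient. This controls the untruncated
tails, which have only second moments. -/
theorem exists_sq_partialSum_le [IsProbabilityMeasure μ] {Y : ℕ → Ω → ℝ}
    (hY : ∀ i, Measurable (Y i))
    (hind : iIndepFun Y μ) (h0 : ∀ i, ∫ ω, Y i ω ∂μ = 0) (hL : ∀ i, MemLp (Y i) 2 μ) (n : ℕ) :
    ∃ W : Ω → ℝ, Integrable W μ ∧ (∀ ω, 0 ≤ W ω) ∧
      (∀ ω, ∀ j ≤ n, (∑ i ∈ Finset.range j, Y i ω) ^ 2 ≤ W ω) ∧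
      ∫ ω, W ω ∂μ ≤ 4 * ∑ i ∈ Finset.range n, ∫ ω, Y i ω ^ 2 ∂μ := by
  have hSL : ∀ n, MemLp (fun ω => ∑ i ∈ Finset.range n, Y i ω) 2 μ := fun n =>
    memLp_finsetSum _ fun i _ => hL i
  have hsm : Measurable (fun x : ℝ => if 0 ≤ x then (1 : ℝ) else -1) :=
    Measurable.ite measurableSet_Ici measurable_const measurable_const
  have hs1 : ∀ x : ℝ, ‖(if 0 ≤ x then (1 : ℝ) else -1)‖ ≤ 1 := fun x => by split_ifs <;> simp
  obtain ⟨h1, h2⟩ := integral_sq_partialSups_le hY hind h0 (fun i => (hL i).integrable (by norm_num))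
    (g := fun x => |x|) (g' := fun x => if 0 ≤ x then 1 else -1) measurable_abs hsm
    (fun x => abs_nonneg x) (by
      intro x y
      split_ifs with h
      · rw [abs_of_nonneg h]; linarith [le_abs_self (x + y)]
      · rw [abs_of_neg (not_le.mp h)]; linarith [neg_le_abs (x + y)])
    (fun n => (hSL n).abs)
    (fun n => MemLp.of_bound
      (hsm.comp (Finset.measurable_fun_sum _ fun i _ => hY i)).aestronglyMeasurable 1
      (Filter.Eventually.of_forall fun ω => hs1 _)) n
  refine ⟨_, h1, fun ω => sq_nonneg _, fun ω j hj => ?_, ?_⟩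
  · rw [← sq_abs]
    exact pow_le_pow_left₀ (abs_nonneg _)
      (le_partialSups_of_le (fun j => |∑ i ∈ Finset.range j, Y i ω|) hj) 2
  · rw [← integral_sq_sum_range hind h0 hL n]
    simpa only [sq_abs] using h2

/-- Integrate `exp x ≤ 1 + x + x²`, valid for `|x| ≤ 1`; the linear term vanishes. -/
theorem mgf_le_exp_of_bounded [IsProbabilityMeasure μ] {Y : Ω → ℝ} {b V t : ℝ} (hY : Measurable Y)
    (h0 : ∫ ω, Y ω ∂μ = 0) (hb : ∀ ω, |Y ω| ≤ b) (htb : |t| * b ≤ 1)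
    (hV : ∫ ω, Y ω ^ 2 ∂μ ≤ V) : mgf Y μ t ≤ Real.exp (t ^ 2 * V) := by
  have hi1 : Integrable Y μ := Integrable.of_bound hY.aestronglyMeasurable b
    (Filter.Eventually.of_forall hb)
  have hi2 : Integrable (fun ω => Y ω ^ 2) μ := Integrable.of_bound (hY.pow_const 2).aestronglyMeasurable (b ^ 2)
    (Filter.Eventually.of_forall fun ω => by
      rw [norm_pow]; exact pow_le_pow_left₀ (norm_nonneg _) (hb ω) 2)
  have hpt : ∀ ω, Real.exp (t * Y ω) ≤ 1 + t * Y ω + t ^ 2 * Y ω ^ 2 := by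
    intro ω
    have h1 : |t * Y ω| ≤ 1 := by
      rw [abs_mul]
      exact (mul_le_mul_of_nonneg_left (hb ω) (abs_nonneg t)).trans htb
    have h2 := Real.abs_exp_sub_one_sub_id_le h1
    have h3 := le_of_abs_le h2
    nlinarith
  have hiE : Integrable (fun ω => Real.exp (t * Y ω)) μ :=
    Integrable.of_bound (by fun_prop) (Real.exp 1) (Filter.Eventually.of_forall fun ω => by
      rw [Real.norm_eq_abs, Real.abs_exp]
      refine Real.exp_le_exp.mpr ((le_abs_self _).trans ?_)
      rw [abs_mul]
      exact (mul_le_mul_of_nonneg_left (hb ω) (abs_nonneg t)).trans htb)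
  have hc : Integrable (fun _ : Ω => (1 : ℝ)) μ := integrable_const 1
  calc mgf Y μ t ≤ ∫ ω, (1 + t * Y ω + t ^ 2 * Y ω ^ 2) ∂μ :=
        integral_mono hiE ((hc.add (hi1.const_mul t)).add (hi2.const_mul _)) hpt
    _ = 1 + t ^ 2 * ∫ ω, Y ω ^ 2 ∂μ := by
        have e := integral_add (hc.add (hi1.const_mul t)) (hi2.const_mul (t ^ 2))
        simp only [Pi.add_apply] at e
        rw [e, integral_add hc (hi1.const_mul t), integral_const_mul, integral_const_mul, h0]
        simp
    _ ≤ 1 + t ^ 2 * V := by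
        have := mul_le_mul_of_nonneg_left hV (sq_nonneg t)
        linarith
    _ ≤ Real.exp (t ^ 2 * V) := by linarith [Real.add_one_le_exp (t ^ 2 * V)]

/-- Doob's inequality for `g x = cosh (t x / 2)`, which treats both signs at once: `exp (t |x|) ≤ 4
g x ^ 2` and `g x ^ 2 ≤ cosh (t x)`. The factor 16 is this 4 times Doob's 4. -/
theorem exists_exp_partialSum_le [IsProbabilityMeasure μ] {Y : ℕ → Ω → ℝ} {b : ℕ → ℝ} {V t : ℝ}
    (hY : ∀ i, Measurable (Y i)) (hind : iIndepFun Y μ) (h0 : ∀ i, ∫ ω, Y i ω ∂μ = 0)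
    (hb : ∀ i ω, |Y i ω| ≤ b i) (hV : ∀ i, ∫ ω, Y i ω ^ 2 ∂μ ≤ V) (ht : 0 ≤ t) {n : ℕ}
    (htb : ∀ i < n, t * b i ≤ 1) :
    ∃ W : Ω → ℝ, Integrable W μ ∧ (∀ ω, 0 ≤ W ω) ∧
      (∀ ω, ∀ j ≤ n, Real.exp (t * |∑ i ∈ Finset.range j, Y i ω|) ≤ W ω) ∧
      ∫ ω, W ω ∂μ ≤ 16 * Real.exp (t ^ 2 * (n * V)) := by
  have hSm : ∀ n, Measurable (fun ω => ∑ i ∈ Finset.range n, Y i ω) := fun n =>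
    Finset.measurable_fun_sum _ fun i _ => hY i
  have hSb : ∀ n ω, |∑ i ∈ Finset.range n, Y i ω| ≤ ∑ i ∈ Finset.range n, b i := fun n ω =>
    (Finset.abs_sum_le_sum_abs _ _).trans (Finset.sum_le_sum fun i _ => hb i ω)
  have hcb : ∀ (u : ℝ) n, ∀ ω, Real.cosh (u * ∑ i ∈ Finset.range n, Y i ω) ≤
      Real.cosh (u * ∑ i ∈ Finset.range n, b i) := by
    intro u n ω
    rw [Real.cosh_le_cosh, abs_mul, abs_mul]
    exact mul_le_mul_of_nonneg_left ((hSb n ω).trans (le_abs_self _)) (abs_nonneg u)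
  have hcm : ∀ u : ℝ, Measurable (fun x : ℝ => Real.cosh (u * x)) := fun u =>
    Real.continuous_cosh.measurable.comp (measurable_const_mul u)
  have hshm : ∀ u : ℝ, Measurable (fun x : ℝ => Real.sinh (u * x)) := fun u =>
    Real.continuous_sinh.measurable.comp (measurable_const_mul u)
  have hcL : ∀ (u : ℝ) n, MemLp (fun ω => Real.cosh (u * ∑ i ∈ Finset.range n, Y i ω)) 2 μ :=
    fun u n => MemLp.of_bound ((hcm u).comp (hSm n)).aestronglyMeasurable _
      (Filter.Eventually.of_forall fun ω => by
        rw [Real.norm_eq_abs, abs_of_pos (Real.cosh_pos _)]; exact hcb u n ω)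
  obtain ⟨h1, h2⟩ := integral_sq_partialSups_le hY hind h0
    (fun i => Integrable.of_bound (hY i).aestronglyMeasurable (b i)
      (Filter.Eventually.of_forall (hb i)))
    (g := fun x => Real.cosh (t / 2 * x)) (g' := fun x => t / 2 * Real.sinh (t / 2 * x))
    (hcm _) ((hshm _).const_mul _) (fun x => (Real.cosh_pos _).le) (by
      intro x y
      have e1 := Real.add_one_le_exp (t / 2 * y)
      have e2 := Real.add_one_le_exp (-(t / 2 * y))
      have p1 := Real.exp_pos (t / 2 * x)
      have p2 := Real.exp_pos (-(t / 2 * x))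
      rw [Real.cosh_eq, Real.cosh_eq, Real.sinh_eq, mul_add, neg_add, Real.exp_add, Real.exp_add]
      nlinarith [mul_le_mul_of_nonneg_left e1 p1.le, mul_le_mul_of_nonneg_left e2 p2.le])
    (hcL _)
    (fun n => by
      refine MemLp.const_mul (MemLp.of_bound ((hshm _).comp (hSm n)).aestronglyMeasurable
        (Real.cosh (t / 2 * ∑ i ∈ Finset.range n, b i)) (Filter.Eventually.of_forall fun ω => ?_)) _
      rw [Real.norm_eq_abs]
      refine le_trans ?_ (hcb _ n ω)
      rw [Function.comp_apply, abs_le, Real.sinh_eq, Real.cosh_eq]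
      have p1 := Real.exp_pos (t / 2 * ∑ i ∈ Finset.range n, Y i ω)
      have p2 := Real.exp_pos (-(t / 2 * ∑ i ∈ Finset.range n, Y i ω))
      constructor <;> linarith) n
  refine ⟨_, h1.const_mul 4, fun ω => mul_nonneg (by norm_num) (sq_nonneg _), fun ω j hj => ?_, ?_⟩
  · set x := ∑ i ∈ Finset.range j, Y i ω with hx
    have e1 : Real.cosh (t / 2 * x) ≤
        partialSups (fun j => Real.cosh (t / 2 * ∑ i ∈ Finset.range j, Y i ω)) n :=
      le_partialSups_of_le (fun j => Real.cosh (t / 2 * ∑ i ∈ Finset.range j, Y i ω)) hj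
    have e2 : Real.exp (t / 2 * |x|) ≤ 2 * Real.cosh (t / 2 * x) := by
      rw [← Real.cosh_abs, abs_mul, abs_of_nonneg (show 0 ≤ t / 2 by positivity), Real.cosh_eq]
      linarith [Real.exp_pos (-(t / 2 * |x|))]
    have e3 : Real.exp (t * |x|) = Real.exp (t / 2 * |x|) ^ 2 := by
      rw [← Real.exp_nat_mul]; congr 1; push_cast; ring
    rw [e3]
    have e4 := pow_le_pow_left₀ (Real.exp_pos _).le (e2.trans (mul_le_mul_of_nonneg_left e1 (by norm_num))) 2
    rw [mul_pow] at e4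
    norm_num at e4 ⊢
    exact e4
  · have hmgf : ∀ u : ℝ, |u| = t →
        ∫ ω, Real.exp (u * ∑ i ∈ Finset.range n, Y i ω) ∂μ ≤ Real.exp (t ^ 2 * (n * V)) := by
      intro u hu
      have e1 := hind.mgf_sum (t := u) hY (Finset.range n)
      have e2 : ∏ i ∈ Finset.range n, mgf (Y i) μ u ≤ ∏ i ∈ Finset.range n, Real.exp (u ^ 2 * V) := by
        refine Finset.prod_le_prod (fun i _ => mgf_nonneg) fun i hi => ?_
        exact mgf_le_exp_of_bounded (hY i) (h0 i) (hb i)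
          (by rw [hu]; exact htb i (Finset.mem_range.mp hi)) (hV i)
      rw [← e1, Finset.prod_const, Finset.card_range, ← Real.exp_nat_mul] at e2
      have e3 : mgf (∑ i ∈ Finset.range n, Y i) μ u =
          ∫ ω, Real.exp (u * ∑ i ∈ Finset.range n, Y i ω) ∂μ := by simp [mgf]
      rw [e3] at e2
      refine e2.trans (Real.exp_le_exp.mpr (le_of_eq ?_))
      rw [← hu, sq_abs]; ring
    have hiE : ∀ u : ℝ, Integrable (fun ω => Real.exp (u * ∑ i ∈ Finset.range n, Y i ω)) μ := by
      intro u
      refine Integrable.of_bound ((hSm n).const_mul u).exp.aestronglyMeasurable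
        (Real.exp (|u| * ∑ i ∈ Finset.range n, b i)) (Filter.Eventually.of_forall fun ω => ?_)
      rw [Real.norm_eq_abs, Real.abs_exp]
      refine Real.exp_le_exp.mpr ((le_abs_self _).trans ?_)
      rw [abs_mul]
      exact mul_le_mul_of_nonneg_left (hSb n ω) (abs_nonneg u)
    have e1 : ∫ ω, Real.cosh (t / 2 * ∑ i ∈ Finset.range n, Y i ω) ^ 2 ∂μ ≤
        ∫ ω, (1 / 2 * Real.exp (t * ∑ i ∈ Finset.range n, Y i ω) +
          1 / 2 * Real.exp (-t * ∑ i ∈ Finset.range n, Y i ω)) ∂μ := by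
      refine integral_mono (hcL _ n).integrable_sq (((hiE _).const_mul _).add ((hiE _).const_mul _)) ?_
      intro ω
      dsimp only
      set x := ∑ i ∈ Finset.range n, Y i ω
      have a1 := Real.cosh_two_mul (t / 2 * x)
      have a2 := Real.cosh_sq (t / 2 * x)
      have a3 := Real.one_le_cosh (2 * (t / 2 * x))
      have a4 : Real.cosh (2 * (t / 2 * x)) =
          1 / 2 * Real.exp (t * x) + 1 / 2 * Real.exp (-t * x) := by
        rw [Real.cosh_eq, show 2 * (t / 2 * x) = t * x by ring, neg_mul]; ring
      rw [← a4]
      linarith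
    rw [integral_add ((hiE _).const_mul _) ((hiE _).const_mul _), integral_const_mul,
      integral_const_mul] at e1
    have e2 := hmgf t (abs_of_nonneg ht)
    have e3 := hmgf (-t) (by rw [abs_neg, abs_of_nonneg ht])
    rw [integral_const_mul]
    linarith

end Maximal

/-! ### Partial sums at dyadic scales. -/

theorem sum_dyadic_average_le {ψ : ℕ → ℝ} (hψ : ∀ i, 0 ≤ ψ i) (L : ℕ) :
    ∑ s ∈ Finset.range L, (∑ i ∈ Finset.range (2 ^ (s + 1)), ψ i) / 2 ^ s ≤
      4 * ∑ i ∈ Finset.range (2 ^ L), ψ i / (i + 1) := by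
  -- Index `i` enters only at scales with `2 ^ (s + 1) > i`, which gives a geometric series of size
  -- at most `4 / (i + 1)`. Its missing tail `2 / 2 ^ L` makes the induction close.
  have key : ∑ s ∈ Finset.range L, (∑ i ∈ Finset.range (2 ^ (s + 1)), ψ i) / 2 ^ s ≤
      ∑ i ∈ Finset.range (2 ^ L), ψ i * (4 / (i + 1) - 2 / 2 ^ L) := by
    induction L with
    | zero => simp; linarith [hψ 0]
    | succ L ih =>
      have hpow : 2 ^ L ≤ 2 ^ (L + 1) := Nat.pow_le_pow_right (by norm_num) (by omega)
      have h2 : (0 : ℝ) < 2 ^ L := by positivity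
      rw [Finset.sum_range_succ, ← Finset.sum_range_add_sum_Ico _ hpow,
        ← Finset.sum_range_add_sum_Ico (fun i : ℕ => ψ i * (4 / ((i : ℝ) + 1) - 2 / 2 ^ (L + 1))) hpow,
        add_div, ← add_assoc]
      refine add_le_add ?_ ?_
      · refine (add_le_add_left ih _).trans (le_of_eq ?_)
        rw [Finset.sum_div, ← Finset.sum_add_distrib]
        refine Finset.sum_congr rfl fun i _ => ?_
        rw [pow_succ]
        field_simp
        ring
      · rw [Finset.sum_div]
        refine Finset.sum_le_sum fun i hi => ?_
        rw [div_eq_mul_one_div]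
        refine mul_le_mul_of_nonneg_left ?_ (hψ i)
        have h3 : (i : ℝ) + 1 ≤ 2 ^ (L + 1) := by exact_mod_cast (Finset.mem_Ico.mp hi).2
        have h4 : 4 / (2 : ℝ) ^ (L + 1) ≤ 4 / ((i : ℝ) + 1) :=
          div_le_div_of_nonneg_left (by norm_num) (by positivity) h3
        have h5 : 4 / (2 : ℝ) ^ (L + 1) - 2 / 2 ^ (L + 1) = 1 / 2 ^ L := by
          rw [pow_succ]; field_simp; norm_num
        linarith
  refine key.trans ?_
  rw [Finset.mul_sum]
  refine Finset.sum_le_sum fun i _ => ?_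
  have h1 : 0 ≤ 2 / (2 : ℝ) ^ L := by positivity
  calc ψ i * (4 / (i + 1) - 2 / 2 ^ L) ≤ ψ i * (4 / (i + 1)) :=
        mul_le_mul_of_nonneg_left (by linarith) (hψ i)
    _ = 4 * (ψ i / (i + 1)) := by ring

/-- For `u ≥ U`, `u² ≤ 8 exp (u / 2)` and half of the exponent is given up. This turns an
exponential moment into a square bound with small excess. -/
theorem sq_le_sq_add_exp {u : ℝ} (hu : 0 ≤ u) (U : ℝ) :
    u ^ 2 ≤ U ^ 2 + 8 * Real.exp (-(U / 2)) * Real.exp u := by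
  rcases le_total u U with h | h
  · have := pow_le_pow_left₀ hu h 2
    have := Real.exp_pos (-(U / 2))
    have := Real.exp_pos u
    nlinarith [mul_pos (Real.exp_pos (-(U / 2))) (Real.exp_pos u)]
  · have h1 : u ^ 2 ≤ 8 * Real.exp (u / 2) := by
      have := Real.quadratic_le_exp_of_nonneg (show 0 ≤ u / 2 by positivity)
      nlinarith
    have h2 : Real.exp (u / 2) ≤ Real.exp (-(U / 2)) * Real.exp u := by
      rw [← Real.exp_add]
      exact Real.exp_le_exp.mpr (by linarith)
    nlinarith [sq_nonneg U]

section Dyadic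

variable {Ω : Type*} [MeasurableSpace Ω] {μ : Measure Ω}

/-- The second moment of `Y` above the truncation level `u` for `Y²`. -/
noncomputable def tailSecondMoment (μ : Measure Ω) (Y : Ω → ℝ) (u : ℝ) : ℝ :=
  ∫ ω, (if Y ω ^ 2 ≤ u then 0 else Y ω ^ 2) ∂μ

theorem tailSecondMoment_nonneg (Y : Ω → ℝ) (u : ℝ) : 0 ≤ tailSecondMoment μ Y u :=
  integral_nonneg fun ω => by dsimp only; split_ifs <;> positivity

/-- A random walk at dyadic scale `s` stays below `T τ` in normalized square, up to an error that
is exponentially small in `τ` plus the contribution of the truncated tails. -/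
theorem exists_dyadic_bound [IsProbabilityMeasure μ] {Y : ℕ → Ω → ℝ} {V τ : ℝ}
    (hY : ∀ i, Measurable (Y i)) (hind : iIndepFun Y μ) (h0 : ∀ i, ∫ ω, Y i ω ∂μ = 0)
    (hL : ∀ i, MemLp (Y i) 2 μ) (hV : ∀ i, ∫ ω, Y i ω ^ 2 ∂μ ≤ V) (hτ : 1 ≤ τ) :
    ∃ R : ℕ → Ω → ℝ, (∀ s, Integrable (R s) μ) ∧ (∀ s ω, 0 ≤ R s ω) ∧
      (∀ ω r, (∑ i ∈ Finset.range (r + 1), Y i ω) ^ 2 ≤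
        (16 * (V / 2 + 2) ^ 2 * τ + R (Nat.log 2 (r + 1)) ω) * 2 ^ Nat.log 2 (r + 1)) ∧
      ∀ L : ℕ, ∑ s ∈ Finset.range L, ∫ ω, R s ω ∂μ ≤
        2048 * Real.exp (-τ) * L +
          32 * ∑ i ∈ Finset.range (2 ^ L), tailSecondMoment μ (Y i) ((i + 1) / τ) / (i + 1) := by
  have hτ0 : 0 < τ := by linarith
  have hV0 : 0 ≤ V := (integral_nonneg fun ω => sq_nonneg (Y 0 ω)).trans (hV 0)
  -- The truncation level grows with the position `i` in the walk. `P` and `Q` are the two parts,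
  -- recentered; their means cancel, so `P + Q = Y`.
  set φ : ℕ → ℝ → ℝ := fun i y => if y ^ 2 ≤ (i + 1) / τ then y else 0 with hφ
  set χ : ℕ → ℝ → ℝ := fun i y => if y ^ 2 ≤ (i + 1) / τ then 0 else y with hχ
  have hφχ : ∀ i y, φ i y + χ i y = y := fun i y => by simp only [hφ, hχ]; split_ifs <;> simp
  have hms : ∀ i : ℕ, MeasurableSet {y : ℝ | y ^ 2 ≤ (i + 1) / τ} := fun i =>
    measurableSet_le (measurable_id.pow_const 2) measurable_const
  have hφm : ∀ i, Measurable (φ i) := fun i => Measurable.ite (hms i) measurable_id measurable_const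
  have hχm : ∀ i, Measurable (χ i) := fun i => Measurable.ite (hms i) measurable_const measurable_id
  have hφY : ∀ i, MemLp (fun ω => φ i (Y i ω)) 2 μ := fun i =>
    (hL i).mono ((hφm i).comp (hY i)).aestronglyMeasurable (Filter.Eventually.of_forall fun ω => by
      simp only [hφ]; split_ifs <;> simp)
  have hχY : ∀ i, MemLp (fun ω => χ i (Y i ω)) 2 μ := fun i =>
    (hL i).mono ((hχm i).comp (hY i)).aestronglyMeasurable (Filter.Eventually.of_forall fun ω => by
      simp only [hχ]; split_ifs <;> simp)
  set c : ℕ → ℝ := fun i => ∫ ω, φ i (Y i ω) ∂μ with hc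
  set d : ℕ → ℝ := fun i => ∫ ω, χ i (Y i ω) ∂μ with hd
  have hcd : ∀ i, c i + d i = 0 := by
    intro i
    rw [← h0 i, ← integral_add ((hφY i).integrable (by norm_num)) ((hχY i).integrable (by norm_num))]
    simp only [hφχ]
  set P : ℕ → Ω → ℝ := fun i ω => φ i (Y i ω) - c i with hP
  set Q : ℕ → Ω → ℝ := fun i ω => χ i (Y i ω) - d i with hQ
  have hPm : ∀ i, Measurable (P i) := fun i => ((hφm i).comp (hY i)).sub_const _
  have hQm : ∀ i, Measurable (Q i) := fun i => ((hχm i).comp (hY i)).sub_const _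
  have hPi : iIndepFun P μ := hind.comp (fun i y => φ i y - c i) fun i => (hφm i).sub_const _
  have hQi : iIndepFun Q μ := hind.comp (fun i y => χ i y - d i) fun i => (hχm i).sub_const _
  have hP0 : ∀ i, ∫ ω, P i ω ∂μ = 0 := fun i => by
    rw [integral_sub ((hφY i).integrable (by norm_num)) (integrable_const _)]; simp [hc]
  have hQ0 : ∀ i, ∫ ω, Q i ω ∂μ = 0 := fun i => by
    rw [integral_sub ((hχY i).integrable (by norm_num)) (integrable_const _)]; simp [hd]
  have hQL : ∀ i, MemLp (Q i) 2 μ := fun i => (hχY i).sub (memLp_const _)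
  have hPV : ∀ i, ∫ ω, P i ω ^ 2 ∂μ ≤ V := by
    intro i
    have e1 := variance_le_expectation_sq (X := fun ω => φ i (Y i ω)) (μ := μ)
      ((hφm i).comp (hY i)).aestronglyMeasurable
    rw [variance_eq_integral (hφY i).1.aemeasurable] at e1
    refine e1.trans (le_trans ?_ (hV i))
    refine integral_mono (hφY i).integrable_sq (hL i).integrable_sq fun ω => ?_
    simp only [hφ, Pi.pow_apply]
    split_ifs
    · exact le_rfl
    · simpa using sq_nonneg (Y i ω)
  have hQV : ∀ i, ∫ ω, Q i ω ^ 2 ∂μ ≤ tailSecondMoment μ (Y i) ((i + 1) / τ) := by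
    intro i
    have e1 := variance_le_expectation_sq (X := fun ω => χ i (Y i ω)) (μ := μ)
      ((hχm i).comp (hY i)).aestronglyMeasurable
    rw [variance_eq_integral (hχY i).1.aemeasurable] at e1
    refine e1.trans (le_of_eq ?_)
    refine integral_congr_ae (Filter.Eventually.of_forall fun ω => ?_)
    simp only [hχ, Pi.pow_apply]
    split_ifs <;> simp
  have hφb : ∀ i ω, |φ i (Y i ω)| ≤ Real.sqrt ((i + 1) / τ) := by
    intro i ω
    simp only [hφ]
    split_ifs with h
    · exact Real.abs_le_sqrt h
    · simp
  have hcb : ∀ i, |c i| ≤ Real.sqrt ((i + 1) / τ) := by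
    intro i
    have := norm_integral_le_of_norm_le_const (μ := μ) (f := fun ω => φ i (Y i ω))
      (Filter.Eventually.of_forall (hφb i))
    simpa using this
  have hPb : ∀ i ω, |P i ω| ≤ 2 * Real.sqrt ((i + 1) / τ) := by
    intro i ω
    have := abs_sub (φ i (Y i ω)) (c i)
    linarith [hφb i ω, hcb i]
  -- The 8 makes `t s` times the bound on `P i` at most 1 for all `i < 2 ^ (s + 1)`, with equality
  -- at the last one.
  set t : ℕ → ℝ := fun s => Real.sqrt (τ / 8 / 2 ^ s) with ht
  have htsq : ∀ s, t s ^ 2 = τ / 8 / 2 ^ s := fun s => Real.sq_sqrt (by positivity)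
  have htb : ∀ s, ∀ i : ℕ, i < 2 ^ (s + 1) → t s * (2 * Real.sqrt ((i + 1) / τ)) ≤ 1 := by
    intro s i hi
    have hi' : (i : ℝ) + 1 ≤ 2 ^ (s + 1) := by exact_mod_cast hi
    refine le_of_sq_le_sq ?_ zero_le_one
    rw [mul_pow, mul_pow, htsq, Real.sq_sqrt (by positivity)]
    rw [pow_succ] at hi'
    have h2 : (0 : ℝ) < 2 ^ s := by positivity
    rw [show τ / 8 / 2 ^ s * (2 ^ 2 * (((i : ℝ) + 1) / τ)) = ((i : ℝ) + 1) / (2 ^ s * 2) by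
      field_simp; norm_num, one_pow, div_le_one (by positivity)]
    exact hi'
  have hWP := fun s : ℕ => exists_exp_partialSum_le hPm hPi hP0 hPb hPV (Real.sqrt_nonneg _) (htb s)
  have hWQ := fun s : ℕ => exists_sq_partialSum_le hQm hQi hQ0 hQL (2 ^ (s + 1))
  choose WP hWPi hWP0 hWPb hWPI using hWP
  choose WQ hWQi hWQ0 hWQb hWQI using hWQ
  -- At scale `s` the exponential moment is at most `16 exp (τ V / 4)`; this `U` gives `exp (-U / 2)
  -- * exp (τ V / 4) = exp (-τ)`.
  set U : ℝ := τ * (V / 2 + 2) with hU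
  have hU0 : 0 ≤ U := by positivity
  refine ⟨fun s ω => 128 * Real.exp (-(U / 2)) * WP s ω + 2 / 2 ^ s * WQ s ω,
    fun s => ((hWPi s).const_mul _).add ((hWQi s).const_mul _),
    fun s ω => add_nonneg (mul_nonneg (by positivity) (hWP0 s ω))
      (mul_nonneg (by positivity) (hWQ0 s ω)), fun ω r => ?_, fun L => ?_⟩
  · set s := Nat.log 2 (r + 1) with hs
    have hr : r + 1 ≤ 2 ^ (s + 1) := (Nat.lt_pow_succ_log_self (by norm_num) _).le
    have h2 : (0 : ℝ) < 2 ^ s := by positivity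
    have e0 : ∑ i ∈ Finset.range (r + 1), Y i ω =
        ∑ i ∈ Finset.range (r + 1), P i ω + ∑ i ∈ Finset.range (r + 1), Q i ω := by
      rw [← Finset.sum_add_distrib]
      refine Finset.sum_congr rfl fun i _ => ?_
      simp only [hP, hQ]
      linarith [hφχ i (Y i ω), hcd i]
    have e1 := hWPb s ω (r + 1) hr
    have e2 := hWQb s ω (r + 1) hr
    set A := ∑ i ∈ Finset.range (r + 1), P i ω
    set B := ∑ i ∈ Finset.range (r + 1), Q i ω
    have e3 := sq_le_sq_add_exp (u := t s * |A|) (mul_nonneg (Real.sqrt_nonneg _) (abs_nonneg _)) U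
    rw [mul_pow, htsq, sq_abs] at e3
    have e4 : τ / 8 / 2 ^ s * A ^ 2 ≤ U ^ 2 + 8 * Real.exp (-(U / 2)) * WP s ω :=
      e3.trans (by
        have := mul_le_mul_of_nonneg_left e1 (show 0 ≤ 8 * Real.exp (-(U / 2)) by positivity)
        linarith)
    have e5 : A ^ 2 ≤ (8 * (V / 2 + 2) ^ 2 * τ + 64 * Real.exp (-(U / 2)) * WP s ω) * 2 ^ s := by
      have e6 : A ^ 2 = (8 / τ * 2 ^ s) * (τ / 8 / 2 ^ s * A ^ 2) := by field_simp
      have e7 : 1 / τ ≤ 1 := by rw [div_le_one hτ0]; exact hτ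
      rw [e6]
      refine (mul_le_mul_of_nonneg_left e4 (by positivity)).trans ?_
      have e8 : 8 / τ * 2 ^ s * (U ^ 2 + 8 * Real.exp (-(U / 2)) * WP s ω) =
          (8 * (V / 2 + 2) ^ 2 * τ + 1 / τ * (64 * Real.exp (-(U / 2)) * WP s ω)) * 2 ^ s := by
        rw [hU]; field_simp; ring
      rw [e8]
      refine mul_le_mul_of_nonneg_right ?_ h2.le
      have e9 : 0 ≤ 64 * Real.exp (-(U / 2)) * WP s ω :=
        mul_nonneg (by positivity) (hWP0 s ω)
      nlinarith
    have e10 : (A + B) ^ 2 ≤ 2 * A ^ 2 + 2 * B ^ 2 := by nlinarith [sq_nonneg (A - B)]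
    rw [e0]
    refine e10.trans ?_
    have e11 : 2 / 2 ^ s * WQ s ω * 2 ^ s = 2 * WQ s ω := by field_simp
    rw [add_mul, add_mul, e11]
    linarith
  · have e1 : ∀ s, ∫ ω, (128 * Real.exp (-(U / 2)) * WP s ω + 2 / 2 ^ s * WQ s ω) ∂μ ≤
        2048 * Real.exp (-τ) + 8 * ((∑ i ∈ Finset.range (2 ^ (s + 1)),
          tailSecondMoment μ (Y i) ((i + 1) / τ)) / 2 ^ s) := by
      intro s
      have h2 : (0 : ℝ) < 2 ^ s := by positivity
      rw [integral_add ((hWPi s).const_mul _) ((hWQi s).const_mul _), integral_const_mul,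
        integral_const_mul]
      refine add_le_add ?_ ?_
      · refine (mul_le_mul_of_nonneg_left (hWPI s) (by positivity)).trans (le_of_eq ?_)
        have : -τ = -(U / 2) + t s ^ 2 * (((2 ^ (s + 1) : ℕ) : ℝ) * V) := by
          rw [htsq, hU]; push_cast; rw [pow_succ]; field_simp; ring
        rw [this, Real.exp_add]
        ring
      · have h3 : ∑ i ∈ Finset.range (2 ^ (s + 1)), ∫ ω, Q i ω ^ 2 ∂μ ≤
            ∑ i ∈ Finset.range (2 ^ (s + 1)), tailSecondMoment μ (Y i) ((i + 1) / τ) :=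
          Finset.sum_le_sum fun i _ => hQV i
        have h4 := mul_le_mul_of_nonneg_left ((hWQI s).trans (mul_le_mul_of_nonneg_left h3 (by norm_num)))
          (show 0 ≤ 2 / (2 : ℝ) ^ s by positivity)
        refine h4.trans (le_of_eq ?_)
        ring
    refine (Finset.sum_le_sum fun s _ => e1 s).trans ?_
    have e2 := sum_dyadic_average_le
      (fun i : ℕ => tailSecondMoment_nonneg (μ := μ) (Y i) (((i : ℝ) + 1) / τ)) L
    simp only [Finset.sum_add_distrib, ← Finset.mul_sum, Finset.sum_const, Finset.card_range,
      nsmul_eq_mul]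
    linarith

end Dyadic

/-! ### Truncated tails under the two moment conditions. -/

/-- Only `i + 1 < τ y²` contribute, so the weights sum to at most a harmonic number, about `1 + log
τ + log y²`. This logarithm is why the `L log L` condition suffices. -/
theorem sum_truncated_sq_div_le (y : ℝ) {τ : ℝ} (hτ : 1 ≤ τ) (N : ℕ) :
    ∑ i ∈ Finset.range N, (if y ^ 2 ≤ ((i : ℝ) + 1) / τ then 0 else y ^ 2) / ((i : ℝ) + 1) ≤
      y ^ 2 * (τ + Real.log (Real.exp 1 + y ^ 2)) := by
  have hτ0 : 0 < τ := by linarith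
  set k := ⌊τ * y ^ 2⌋₊ with hk
  have hlog : 0 ≤ Real.log (Real.exp 1 + y ^ 2) := by
    refine Real.log_nonneg ?_
    have := Real.add_one_le_exp (1 : ℝ)
    nlinarith [sq_nonneg y]
  have h1 : ∑ i ∈ Finset.range N, (if y ^ 2 ≤ ((i : ℝ) + 1) / τ then 0 else y ^ 2) / ((i : ℝ) + 1) ≤
      ∑ i ∈ Finset.range k, y ^ 2 * ((i : ℝ) + 1)⁻¹ := by
    rw [← Finset.sum_filter_add_sum_filter_not (Finset.range N) (fun i => i < k),
      Finset.sum_eq_zero (s := Finset.filter (fun i => ¬ i < k) _), add_zero]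
    · calc ∑ i ∈ Finset.range N with i < k,
            (if y ^ 2 ≤ ((i : ℝ) + 1) / τ then 0 else y ^ 2) / ((i : ℝ) + 1)
          ≤ ∑ i ∈ Finset.range N with i < k, y ^ 2 * ((i : ℝ) + 1)⁻¹ := by
            refine Finset.sum_le_sum fun i _ => ?_
            rw [div_eq_mul_inv]
            refine mul_le_mul_of_nonneg_right ?_ (by positivity)
            split_ifs
            · positivity
            · exact le_rfl
        _ ≤ ∑ i ∈ Finset.range k, y ^ 2 * ((i : ℝ) + 1)⁻¹ := by
            refine Finset.sum_le_sum_of_subset_of_nonneg ?_ fun _ _ _ => by positivity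
            intro i hi
            exact Finset.mem_range.mpr (Finset.mem_filter.mp hi).2
    · intro i hi
      have h2 : k < i + 1 := by have := (Finset.mem_filter.mp hi).2; omega
      have h3 := (Nat.floor_lt (by positivity)).mp h2
      push_cast at h3
      rw [if_pos, zero_div]
      rw [le_div_iff₀ hτ0]
      linarith
  refine h1.trans ?_
  rw [← Finset.mul_sum]
  refine mul_le_mul_of_nonneg_left ?_ (sq_nonneg y)
  have h4 : ∑ i ∈ Finset.range k, ((i : ℝ) + 1)⁻¹ = ((harmonic k : ℚ) : ℝ) := by
    simp [harmonic]
  rw [h4]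
  rcases lt_or_ge (τ * y ^ 2) 1 with h | h
  · have : k = 0 := Nat.floor_eq_zero.mpr h
    rw [this]
    simp
    linarith
  · have h5 := harmonic_floor_le_one_add_log _ h
    have hy : 0 < y ^ 2 := by
      by_contra hy
      nlinarith [sq_nonneg y]
    rw [Real.log_mul hτ0.ne' hy.ne'] at h5
    have h6 := Real.log_le_sub_one_of_pos hτ0
    have h7 : Real.log (y ^ 2) ≤ Real.log (Real.exp 1 + y ^ 2) :=
      Real.log_le_log hy (by linarith [Real.exp_pos 1])
    rw [← hk] at h5
    linarith

section Moments

variable {Ω : Type*} [MeasurableSpace Ω] {μ : Measure Ω}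

theorem integrable_truncated_sq {Y : Ω → ℝ} (hY : Measurable Y) (hY2 : Integrable (fun ω => Y ω ^ 2) μ)
    (u : ℝ) : Integrable (fun ω => if Y ω ^ 2 ≤ u then 0 else Y ω ^ 2) μ := by
  refine hY2.mono (Measurable.ite (measurableSet_le (hY.pow_const 2) measurable_const)
    measurable_const (hY.pow_const 2)).aestronglyMeasurable (Filter.Eventually.of_forall fun ω => ?_)
  split_ifs <;> simp [sq_nonneg]

theorem integral_sq_le_of_rpow [IsProbabilityMeasure μ] {Y : Ω → ℝ} {ε C : ℝ} (hε : 0 < ε)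
    (hY : Measurable Y) (hi : Integrable (fun ω => |Y ω| ^ (2 + ε)) μ)
    (hC : ∫ ω, |Y ω| ^ (2 + ε) ∂μ ≤ C) :
    Integrable (fun ω => Y ω ^ 2) μ ∧ ∫ ω, Y ω ^ 2 ∂μ ≤ 1 + C := by
  have hpt : ∀ ω, Y ω ^ 2 ≤ 1 + |Y ω| ^ (2 + ε) := by
    intro ω
    rw [← sq_abs]
    have h0 : 0 ≤ |Y ω| ^ (2 + ε) := by positivity
    rcases le_total |Y ω| 1 with h | h
    · nlinarith [abs_nonneg (Y ω)]
    · have := Real.rpow_le_rpow_of_exponent_le h (show (2 : ℝ) ≤ 2 + ε by linarith)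
      rw [Real.rpow_two] at this
      linarith
  have hI : Integrable (fun ω => 1 + |Y ω| ^ (2 + ε)) μ := (integrable_const 1).add hi
  have h2 : Integrable (fun ω => Y ω ^ 2) μ :=
    hI.mono' (hY.pow_const 2).aestronglyMeasurable (Filter.Eventually.of_forall fun ω => by
      rw [Real.norm_of_nonneg (sq_nonneg _)]; exact hpt ω)
  refine ⟨h2, (integral_mono h2 hI hpt).trans ?_⟩
  rw [integral_add (integrable_const 1) hi]
  simpa using hC

/-- Markov: where `Y² > u`, `|Y| ^ ε ≥ u ^ (ε / 2)`. The extra decay makes the harmonic sum of tails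
converge. -/
theorem tailSecondMoment_le_of_rpow {Y : Ω → ℝ} {ε C u : ℝ} (hε : 0 < ε)
    (hY : Measurable Y) (hY2 : Integrable (fun ω => Y ω ^ 2) μ)
    (hi : Integrable (fun ω => |Y ω| ^ (2 + ε)) μ)
    (hC : ∫ ω, |Y ω| ^ (2 + ε) ∂μ ≤ C) (hu : 0 < u) :
    tailSecondMoment μ Y u ≤ C * u ^ (-(ε / 2)) := by
  calc tailSecondMoment μ Y u ≤ ∫ ω, |Y ω| ^ (2 + ε) * u ^ (-(ε / 2)) ∂μ := by
        refine integral_mono (integrable_truncated_sq hY hY2 u) (hi.mul_const _) fun ω => ?_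
        dsimp only
        split_ifs with h
        · positivity
        · rw [not_le] at h
          have h1 : 0 < |Y ω| := by
            rw [abs_pos]
            intro h0
            rw [h0] at h
            norm_num at h
            linarith
          rw [Real.rpow_add h1, Real.rpow_two, sq_abs, Real.rpow_neg hu.le, mul_assoc,
            ← div_eq_mul_inv]
          refine le_mul_of_one_le_right (sq_nonneg _) ?_
          rw [one_le_div (by positivity)]
          have h2 : |Y ω| ^ ε = (Y ω ^ 2) ^ (ε / 2) := by
            rw [← sq_abs, ← Real.rpow_two, ← Real.rpow_mul h1.le]
            congr 1; ring
          rw [h2]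
          exact Real.rpow_le_rpow hu.le h.le (by positivity)
    _ = (∫ ω, |Y ω| ^ (2 + ε) ∂μ) * u ^ (-(ε / 2)) := integral_mul_const _ _
    _ ≤ C * u ^ (-(ε / 2)) := mul_le_mul_of_nonneg_right hC (by positivity)

/-- The constant in the bound on truncated tails. -/
noncomputable def tailConstant (ε C₁ : ℝ) : ℝ :=
  C₁ * ∑' i : ℕ, 1 / ((i : ℝ) + 1) ^ (1 + ε / 2) + 2 * C₁

theorem tailConstant_nonneg {ε C₁ : ℝ} (hC₁ : 0 ≤ C₁) : 0 ≤ tailConstant ε C₁ := by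
  have : 0 ≤ ∑' i : ℕ, 1 / ((i : ℝ) + 1) ^ (1 + ε / 2) := tsum_nonneg fun i => by positivity
  unfold tailConstant
  positivity

/-- Either moment condition bounds the second moments and the harmonic sums of truncated tails. -/
theorem ErrorMomentCondition.bounds [IsProbabilityMeasure μ] {n : ℕ} {ε C₁ σ : ℝ}
    (hε : ε ∈ Set.Ioo (0 : ℝ) 1)
    (hC₁ : 0 ≤ C₁) {Z : Fin n → Ω → ℝ} (hZ : ∀ i, Measurable (Z i))
    (h : ErrorMomentCondition μ ε C₁ σ Z) :
    (∀ i, Integrable (fun ω => (Z i ω / σ) ^ 2) μ ∧ ∫ ω, (Z i ω / σ) ^ 2 ∂μ ≤ 1 + C₁) ∧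
      ∀ τ : ℝ, 1 ≤ τ → ∀ (e : ℕ → Fin n) (N : ℕ),
        ∑ i ∈ Finset.range N,
          tailSecondMoment μ (fun ω => Z (e i) ω / σ) (((i : ℝ) + 1) / τ) / ((i : ℝ) + 1) ≤
            tailConstant ε C₁ * τ := by
  have hYm : ∀ i, Measurable fun ω => Z i ω / σ := fun i => (hZ i).div_const σ
  have hsum0 : 0 ≤ ∑' i : ℕ, 1 / ((i : ℝ) + 1) ^ (1 + ε / 2) := tsum_nonneg fun i => by positivity
  rcases h with h | ⟨hid, h⟩
  · have h2 := fun i => integral_sq_le_of_rpow hε.1 (hYm i) (h i).1 (h i).2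
    refine ⟨h2, fun τ hτ e N => ?_⟩
    have hτ0 : 0 < τ := by linarith
    have hsummable : Summable fun i : ℕ => 1 / ((i : ℝ) + 1) ^ (1 + ε / 2) := by
      have := (summable_nat_add_iff 1).mpr
        (Real.summable_one_div_nat_rpow.mpr (show 1 < 1 + ε / 2 by linarith [hε.1]))
      simpa using this
    have hterm : ∀ i : ℕ,
        tailSecondMoment μ (fun ω => Z (e i) ω / σ) (((i : ℝ) + 1) / τ) / ((i : ℝ) + 1) ≤
          C₁ * τ ^ (ε / 2) * (1 / ((i : ℝ) + 1) ^ (1 + ε / 2)) := by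
      intro i
      have hi : (0 : ℝ) < (i : ℝ) + 1 := by positivity
      have h3 := tailSecondMoment_le_of_rpow (u := ((i : ℝ) + 1) / τ) hε.1 (hYm (e i)) (h2 (e i)).1
        (h (e i)).1 (h (e i)).2 (by positivity)
      refine (div_le_div_of_nonneg_right h3 hi.le).trans (le_of_eq ?_)
      rw [Real.div_rpow hi.le hτ0.le, Real.rpow_neg hi.le, Real.rpow_neg hτ0.le, Real.rpow_add hi,
        Real.rpow_one]
      field_simp
    calc _ ≤ ∑ i ∈ Finset.range N, C₁ * τ ^ (ε / 2) * (1 / ((i : ℝ) + 1) ^ (1 + ε / 2)) :=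
          Finset.sum_le_sum fun i _ => hterm i
      _ = C₁ * τ ^ (ε / 2) * ∑ i ∈ Finset.range N, 1 / ((i : ℝ) + 1) ^ (1 + ε / 2) :=
          (Finset.mul_sum _ _ _).symm
      _ ≤ C₁ * τ ^ (ε / 2) * ∑' i : ℕ, 1 / ((i : ℝ) + 1) ^ (1 + ε / 2) :=
          mul_le_mul_of_nonneg_left (hsummable.sum_le_tsum _ fun i _ => by positivity)
            (by positivity)
      _ ≤ tailConstant ε C₁ * τ := by
          have h4 : τ ^ (ε / 2) ≤ τ := by
            have := Real.rpow_le_rpow_of_exponent_le hτ (show ε / 2 ≤ 1 by linarith [hε.1, hε.2])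
            rwa [Real.rpow_one] at this
          have h5 := mul_le_mul_of_nonneg_right (mul_le_mul_of_nonneg_left h4 hC₁) hsum0
          have h6 : 0 ≤ 2 * C₁ * τ := by positivity
          unfold tailConstant
          nlinarith
  · have hexp : ∀ x : ℝ, 1 ≤ Real.log (Real.exp 1 + x ^ 2) := by
      intro x
      rw [Real.le_log_iff_exp_le (by positivity)]
      linarith [sq_nonneg x]
    simp only [← div_pow] at h
    have hpt : ∀ i ω, (Z i ω / σ) ^ 2 ≤
        (Z i ω / σ) ^ 2 * Real.log (Real.exp 1 + (Z i ω / σ) ^ 2) := fun i ω =>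
      le_mul_of_one_le_right (sq_nonneg _) (hexp _)
    have hi2 : ∀ i, Integrable (fun ω => (Z i ω / σ) ^ 2) μ := fun i =>
      (h i).1.mono' ((hYm i).pow_const 2).aestronglyMeasurable
        (Filter.Eventually.of_forall fun ω => by
          rw [Real.norm_of_nonneg (sq_nonneg _)]; exact hpt i ω)
    have hle : ∀ i, ∫ ω, (Z i ω / σ) ^ 2 ∂μ ≤ C₁ := fun i =>
      (integral_mono (hi2 i) (h i).1 (hpt i)).trans (h i).2
    refine ⟨fun i => ⟨hi2 i, (hle i).trans (by linarith)⟩, fun τ hτ e N => ?_⟩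
    -- A common law moves all truncations onto one variable, so the harmonic sum can be taken
    -- pointwise before integrating.
    have hsame : ∀ i u, tailSecondMoment μ (fun ω => Z (e i) ω / σ) u =
        tailSecondMoment μ (fun ω => Z (e 0) ω / σ) u := by
      intro i u
      have hm : Measurable fun x : ℝ => if (x / σ) ^ 2 ≤ u then 0 else (x / σ) ^ 2 :=
        Measurable.ite (measurableSet_le ((measurable_id.div_const σ).pow_const 2) measurable_const)
          measurable_const ((measurable_id.div_const σ).pow_const 2)
      exact ((hid (e i) (e 0)).comp hm).integral_eq
    simp only [hsame]
    set Y : Ω → ℝ := fun ω => Z (e 0) ω / σ with hYdef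
    have hI : Integrable (fun ω => Y ω ^ 2 * (τ + Real.log (Real.exp 1 + Y ω ^ 2))) μ := by
      simp only [mul_add]
      exact ((hi2 (e 0)).mul_const τ).add (h (e 0)).1
    calc ∑ i ∈ Finset.range N, tailSecondMoment μ Y (((i : ℝ) + 1) / τ) / ((i : ℝ) + 1)
        = ∫ ω, ∑ i ∈ Finset.range N,
            (if Y ω ^ 2 ≤ ((i : ℝ) + 1) / τ then 0 else Y ω ^ 2) / ((i : ℝ) + 1) ∂μ := by
          rw [integral_finsetSum _ fun i _ =>
            (integrable_truncated_sq (hYm (e 0)) (hi2 (e 0)) _).div_const _]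
          refine Finset.sum_congr rfl fun i _ => ?_
          rw [integral_div]
          rfl
      _ ≤ ∫ ω, Y ω ^ 2 * (τ + Real.log (Real.exp 1 + Y ω ^ 2)) ∂μ :=
          integral_mono (integrable_finsetSum _ fun i _ =>
            (integrable_truncated_sq (hYm (e 0)) (hi2 (e 0)) _).div_const _) hI
            fun ω => sum_truncated_sq_div_le (Y ω) hτ N
      _ = (∫ ω, Y ω ^ 2 ∂μ) * τ + ∫ ω, Y ω ^ 2 * Real.log (Real.exp 1 + Y ω ^ 2) ∂μ := by
          simp only [mul_add]
          rw [integral_add ((hi2 (e 0)).mul_const τ) (h (e 0)).1, integral_mul_const]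
      _ ≤ C₁ * τ + C₁ :=
          add_le_add (mul_le_mul_of_nonneg_right (hle (e 0)) (by linarith)) (h (e 0)).2
      -- Since `1 ≤ τ`, the summand `2 * C₁` of the constant covers this case; the series covers the
      -- other.
      _ ≤ tailConstant ε C₁ * τ := by
          unfold tailConstant
          have := mul_nonneg (mul_nonneg hC₁ hsum0) (show 0 ≤ τ by linarith)
          nlinarith

end Moments

/-! ### Extension of the noise to all integers, so that walks may run past either end of the data.
-/

/-- Adding constant zero variables to an independent family keeps it independent. -/
theorem iIndepFun_of_extend_zero {Ω ι κ : Type*} [MeasurableSpace Ω] {μ : Measure Ω}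
    [IsProbabilityMeasure μ] {f : ι → Ω → ℝ} {g : κ → Ω → ℝ} {e : ι → κ} (he : Function.Injective e)
    (hf : iIndepFun f μ) (hge : ∀ i, g (e i) = f i) (hg0 : ∀ j, j ∉ Set.range e → g j = 0) :
    iIndepFun g μ := by
  classical
  rw [iIndepFun_iff_measure_inter_preimage_eq_mul] at hf ⊢
  intro S A hA
  -- A set that misses 0 at an added index makes both sides vanish; otherwise the added events are
  -- the whole space and drop out.
  by_cases h : ∃ j ∈ S, j ∉ Set.range e ∧ (0 : ℝ) ∉ A j
  · obtain ⟨j, hjS, hj, h0⟩ := h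
    have h1 : g j ⁻¹' A j = ∅ := by
      ext ω
      simp [hg0 j hj, h0]
    rw [Finset.prod_eq_zero hjS (by rw [h1]; simp)]
    refine measure_mono_null (Set.biInter_subset_of_mem (t := fun i => g i ⁻¹' A i) hjS) ?_
    rw [h1]; simp
  · push Not at h
    have hu : ∀ j ∈ S, j ∉ Set.range e → g j ⁻¹' A j = Set.univ := fun j hj hje => by
      ext ω
      simp [hg0 j hje, h j hj hje]
    have h2 := hf (S.preimage e he.injOn) (sets := fun i => A (e i))
      (fun i hi => hA _ (Finset.mem_preimage.mp hi))
    have h3 : ⋂ j ∈ S, g j ⁻¹' A j = ⋂ i ∈ S.preimage e he.injOn, f i ⁻¹' A (e i) := by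
      ext ω
      simp only [Set.mem_iInter, Finset.mem_preimage]
      constructor
      · intro hω i hi
        rw [← hge i]
        exact hω _ hi
      · intro hω j hj
        by_cases hje : j ∈ Set.range e
        · obtain ⟨i, rfl⟩ := hje
          rw [hge i]
          exact hω i hj
        · rw [hu j hj hje]; trivial
    rw [h3, h2]
    rw [← Finset.prod_preimage e S he.injOn (fun j => μ (g j ⁻¹' A j))
      (fun j hj hje => by rw [hu j hj hje]; simp)]
    refine Finset.prod_congr rfl fun i _ => ?_
    rw [hge i]

/-- The extension of a finite sequence to all integers by zero. -/
def zeroExtend {α : Type*} {n : ℕ} (Z : Fin n → α → ℝ) (i : ℤ) (x : α) : ℝ :=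
  if h : 0 ≤ i ∧ i < n then Z ⟨i.toNat, by omega⟩ x else 0

theorem zeroExtend_natCast {α : Type*} {n : ℕ} (Z : Fin n → α → ℝ) (i : Fin n) :
    zeroExtend Z ((i : ℕ) : ℤ) = Z i := by
  ext x
  simp [zeroExtend]

theorem zeroExtend_eq_or {α : Type*} {n : ℕ} (Z : Fin n → α → ℝ) (i : ℤ) :
    (∃ j, zeroExtend Z i = Z j) ∨ zeroExtend Z i = 0 := by
  by_cases h : 0 ≤ i ∧ i < n
  · exact Or.inl ⟨⟨i.toNat, by omega⟩, by ext x; simp [zeroExtend, h]⟩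
  · exact Or.inr (by ext x; simp [zeroExtend, h])

theorem iIndepFun_zeroExtend {Ω : Type*} [MeasurableSpace Ω] {μ : Measure Ω}
    [IsProbabilityMeasure μ] {n : ℕ} {Z : Fin n → Ω → ℝ} (hZ : iIndepFun Z μ) :
    iIndepFun (zeroExtend Z) μ := by
  refine iIndepFun_of_extend_zero (e := fun i : Fin n => ((i : ℕ) : ℤ)) ?_ hZ
    (zeroExtend_natCast Z) ?_
  · intro i j hij
    simpa [Fin.ext_iff] using hij
  · intro j hj
    ext x
    rw [zeroExtend, dif_neg]
    · rfl
    · rintro ⟨h1, h2⟩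
      exact hj ⟨⟨j.toNat, by omega⟩, by simp [h1]⟩

/-! ### Blocks, jumps and the deterministic noise bound. -/

theorem exists_block {b : ℕ → ℕ} (hb0 : b 0 = 0) {k i : ℕ} (hi : i < b k) :
    ∃ l < k, b l ≤ i ∧ i < b (l + 1) := by
  induction k with
  | zero => omega
  | succ k ih =>
    by_cases h : i < b k
    · obtain ⟨l, hl, h'⟩ := ih h
      exact ⟨l, by omega, h'⟩
    · exact ⟨k, by omega, by omega, hi⟩

theorem sum_blocks {M : Type*} [AddCommMonoid M] {b : ℕ → ℕ} (hb0 : b 0 = 0) (hb : Monotone b)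
    (f : ℕ → M) (k : ℕ) :
    ∑ l ∈ Finset.range k, ∑ i ∈ Finset.Ico (b l) (b (l + 1)), f i =
      ∑ i ∈ Finset.range (b k), f i := by
  induction k with
  | zero => simp [hb0]
  | succ k ih => rw [Finset.sum_range_succ, ih, Finset.sum_range_add_sum_Ico _ (hb (Nat.le_succ k))]

theorem exists_breakpoints {n k : ℕ} (hn : 0 < n) {θ : EuclideanSpace ℝ (Fin n)}
    (hθ : θ ∈ isotonicPieces n k) :
    (∀ i i' : Fin n, i ≤ i' → θ i ≤ θ i') ∧ ∃ b : ℕ → ℕ, b 0 = 0 ∧ Monotone b ∧ b k = n ∧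
      ∀ l < k, ∀ i i' : Fin n, b l ≤ i → (i : ℕ) < b (l + 1) → b l ≤ i' → (i' : ℕ) < b (l + 1) →
        θ i = θ i' := by
  obtain ⟨a, ⟨h0, ha, hl⟩, hmono, hc⟩ := (mem_isotonicPieces_iff hn θ).mp hθ
  -- Breakpoints stay at `n` after index `k`. Blocks become `[b l, b (l + 1))` in zero-based
  -- coordinates and may be empty.
  refine ⟨hmono, fun l => a ⟨min l k, by omega⟩, ?_, ?_, ?_, ?_⟩
  · simp [h0]
  · intro l l' hll
    exact ha (show (⟨min l k, by omega⟩ : Fin (k + 1)) ≤ ⟨min l' k, by omega⟩ from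
      min_le_min_right k hll)
  · have h : a ⟨k, by omega⟩ = Fin.last n := hl
    simp [h]
  · intro l hlk i i' h1 h2 h3 h4
    have e1 : (⟨min l k, by omega⟩ : Fin (k + 1)) = (⟨l, hlk⟩ : Fin k).castSucc := by
      ext; simp; omega
    have e2 : (⟨min (l + 1) k, by omega⟩ : Fin (k + 1)) = (⟨l, hlk⟩ : Fin k).succ := by
      ext; simp; omega
    simp only [e1, e2] at h1 h2 h3 h4
    exact hc ⟨l, hlk⟩ i i' ⟨by omega, by omega⟩ ⟨by omega, by omega⟩

/-- A jump between `i` and `i + 1` forces `i + 1` to be one of the `k + 1` breakpoints. -/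
theorem card_jumps_le {n k : ℕ} (hn : 0 < n) {θ : EuclideanSpace ℝ (Fin n)}
    (hθ : θ ∈ isotonicPieces n k) :
    ((Finset.range n).filter fun i => ∃ h : i + 1 < n,
      θ ⟨i, by omega⟩ ≠ θ ⟨i + 1, h⟩).card ≤ k + 1 := by
  classical
  obtain ⟨-, b, hb0, -, hbk, hc⟩ := exists_breakpoints hn hθ
  rw [← Finset.card_image_of_injective _ (add_left_injective 1)]
  have hsub : (((Finset.range n).filter fun i => ∃ h : i + 1 < n,
      θ ⟨i, by omega⟩ ≠ θ ⟨i + 1, h⟩).image fun i => i + 1) ⊆ (Finset.range (k + 1)).image b := by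
    intro j hj
    obtain ⟨i, hi, rfl⟩ := Finset.mem_image.mp hj
    obtain ⟨hin, h1, h2⟩ := Finset.mem_filter.mp hi
    rw [Finset.mem_range] at hin
    obtain ⟨l, hlk, hl1, hl2⟩ := exists_block hb0 (show i < b k by omega)
    refine Finset.mem_image.mpr ⟨l + 1, by simp; omega, ?_⟩
    by_contra hne
    exact h2 (hc l hlk _ _ hl1 hl2 (by simp; omega) (by simp; omega))
  exact (Finset.card_le_card hsub).trans (Finset.card_image_le.trans (by simp))

/-- Deterministic bound on the noise against the difference of two fits, in terms of the dyadic
behaviour of the partial sums of the noise from both ends of each block of `η`. -/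
theorem two_mul_sum_noise_le {n k : ℕ} (hn : 0 < n) (hk : 1 ≤ k) {θ η : EuclideanSpace ℝ (Fin n)}
    (hθ : θ ∈ isotonicPieces n k) {b : ℕ → ℕ} (hb0 : b 0 = 0) (hb : Monotone b) (hbk : b k = n)
    (hc : ∀ l < k, ∀ i i' : Fin n, b l ≤ i → (i : ℕ) < b (l + 1) → b l ≤ i' → (i' : ℕ) < b (l + 1) →
        η i = η i')
    {z : ℤ → ℝ} {T : ℝ} (hT : 0 ≤ T) {R R' : ℕ → ℕ → ℝ} (hR : ∀ l s, 0 ≤ R l s)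
    (hR' : ∀ l s, 0 ≤ R' l s)
    (hS : ∀ l r : ℕ, (∑ i ∈ Finset.range (r + 1), z (b l + i)) ^ 2 ≤
      (T + R l (Nat.log 2 (r + 1))) * 2 ^ Nat.log 2 (r + 1))
    (hS' : ∀ l r : ℕ, (∑ i ∈ Finset.range (r + 1), z (b (l + 1) - 1 - i)) ^ 2 ≤
      (T + R' l (Nat.log 2 (r + 1))) * 2 ^ Nat.log 2 (r + 1)) :
    2 * ∑ i : Fin n, z (i : ℕ) * (θ i - η i) ≤
      (48 * k * T + 8 * ∑ l ∈ Finset.range k,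
        (∑ s ∈ Finset.range (Nat.log 2 (b (l + 1) - b l) + 1), R l s +
          ∑ s ∈ Finset.range (Nat.log 2 (b (l + 1) - b l) + 1), R' l s)) +
        1 / 4 * ∑ i : Fin n, (θ i - η i) ^ 2 := by
  classical
  have hmono := (exists_breakpoints hn hθ).1
  set w : ℕ → ℝ := fun i => if h : i < n then θ ⟨i, h⟩ - η ⟨i, h⟩ else 0 with hw
  have hwi : ∀ i : Fin n, w i = θ i - η i := fun i => by simp [hw]
  have hble : ∀ l, l ≤ k → b l ≤ n := fun l hl => hbk ▸ hb hl
  have e1 : ∑ i : Fin n, z (i : ℕ) * (θ i - η i) =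
      ∑ l ∈ Finset.range k, ∑ i ∈ Finset.Ico (b l) (b (l + 1)), z i * w i := by
    rw [sum_blocks hb0 hb (fun i : ℕ => z i * w i), hbk, Finset.sum_range]
    simp only [hwi]
  have e2 : ∑ i : Fin n, (θ i - η i) ^ 2 =
      ∑ l ∈ Finset.range k, ∑ i ∈ Finset.Ico (b l) (b (l + 1)), w i ^ 2 := by
    rw [sum_blocks hb0 hb (fun i : ℕ => w i ^ 2), hbk, Finset.sum_range]
    simp only [hwi]
  have hblock : ∀ l ∈ Finset.range k, 2 * ∑ i ∈ Finset.Ico (b l) (b (l + 1)), z i * w i ≤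
      16 * T * (1 + ((Finset.Ico (b l) (b (l + 1))).filter fun i =>
        i + 1 < b (l + 1) ∧ w i ≠ w (i + 1)).card) +
        8 * (∑ s ∈ Finset.range (Nat.log 2 (b (l + 1) - b l) + 1), R l s +
          ∑ s ∈ Finset.range (Nat.log 2 (b (l + 1) - b l) + 1), R' l s) +
          1 / 4 * ∑ i ∈ Finset.Ico (b l) (b (l + 1)), w i ^ 2 := by
    intro l hl
    rw [Finset.mem_range] at hl
    refine two_mul_sum_Ico_mul_le_of_monotoneOn ?_ hT (hR l) (hR' l) (fun r _ => hS l r)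
      (fun r _ => hS' l r)
    intro i j hi hij hj
    have hj' : j < n := lt_of_lt_of_le hj (hble _ (by omega))
    simp only [hw, hj', show i < n by omega, dif_pos]
    rw [hc l hl ⟨i, by omega⟩ ⟨j, hj'⟩ hi (by simp; omega) (by simp; omega) hj]
    exact sub_le_sub_right (hmono _ _ hij) _
  -- Inside a block `η` is constant, so jumps of `w` are jumps of `θ`; disjoint blocks count each at
  -- most once.
  have hcard : ∑ l ∈ Finset.range k, ((Finset.Ico (b l) (b (l + 1))).filter fun i =>
        i + 1 < b (l + 1) ∧ w i ≠ w (i + 1)).card ≤ k + 1 := by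
    refine le_trans ?_ (card_jumps_le hn hθ)
    have e := sum_blocks hb0 hb (fun i => if ∃ h : i + 1 < n,
      θ ⟨i, by omega⟩ ≠ θ ⟨i + 1, h⟩ then 1 else 0) k
    rw [hbk] at e
    rw [Finset.card_filter, ← e]
    refine Finset.sum_le_sum fun l hl => ?_
    rw [Finset.mem_range] at hl
    rw [← Finset.card_filter]
    refine Finset.card_le_card ?_
    intro i hi
    obtain ⟨h1, h2, h3⟩ := Finset.mem_filter.mp hi
    refine Finset.mem_filter.mpr ⟨h1, ?_⟩
    rw [Finset.mem_Ico] at h1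
    have h4 : i + 1 < n := lt_of_lt_of_le h2 (hble _ (by omega))
    refine ⟨by omega, fun h5 => h3 ?_⟩
    simp only [hw, h4, show i < n by omega, dif_pos]
    rw [h5, hc l hl ⟨i, by omega⟩ ⟨i + 1, h4⟩ h1.1 h1.2 (by simp; omega) h2]
  have hcard' : ∑ l ∈ Finset.range k, (((Finset.Ico (b l) (b (l + 1))).filter fun i =>
        i + 1 < b (l + 1) ∧ w i ≠ w (i + 1)).card : ℝ) ≤ k + 1 := by exact_mod_cast hcard
  have hk' : (1 : ℝ) ≤ k := by exact_mod_cast hk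
  rw [e1, e2, Finset.mul_sum]
  refine (Finset.sum_le_sum hblock).trans ?_
  simp only [Finset.sum_add_distrib, ← Finset.mul_sum, Finset.sum_const, Finset.card_range,
    nsmul_eq_mul, mul_one]
  -- In total `16 T (k + (k + 1)) ≤ 48 k T`, as `1 ≤ k`.
  have := mul_le_mul_of_nonneg_left hcard' (show 0 ≤ 16 * T by positivity)
  nlinarith

/-! ### Basic inequality, number of scales and expected noise. -/

/-- The basic inequality for least squares over a nonconvex class. -/
theorem IsReducedIsotonicLSE.norm_sub_sq_le {n k : ℕ} {x θ η θstar : EuclideanSpace ℝ (Fin n)} {G : ℝ}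
    (h : IsReducedIsotonicLSE k x θ) (hη : η ∈ isotonicPieces n k)
    (hG : 2 * ∑ i, (x i - θstar i) * (θ i - η i) ≤ G + 1 / 4 * ∑ i, (θ i - η i) ^ 2) :
    ‖θ - θstar‖ ^ 2 ≤ 18 * ‖η - θstar‖ ^ 2 + 4 * G := by
  have h1 := h.2 η hη
  simp only [EuclideanSpace.norm_sq_eq, Real.norm_eq_abs, sq_abs, PiLp.sub_apply] at h1 ⊢
  have h2 : ∀ i, (x i - η i) ^ 2 = (x i - θ i) ^ 2 + 2 * ((x i - θstar i) * (θ i - η i)) +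
      2 * ((θstar i - η i) * (θ i - η i)) - (θ i - η i) ^ 2 := fun i => by ring
  simp only [h2, Finset.sum_add_distrib, Finset.sum_sub_distrib, ← Finset.mul_sum] at h1
  -- With `D = ‖θ - η‖²` and `d = ‖η - θstar‖²`, minimality gives `D ≤ G + 4 d + D / 2`; then `2 D +
  -- 2 d ≤ 18 d + 4 G`.
  have h3 : 2 * ∑ i, (θstar i - η i) * (θ i - η i) ≤
      4 * ∑ i, (η i - θstar i) ^ 2 + 1 / 4 * ∑ i, (θ i - η i) ^ 2 := by
    rw [Finset.mul_sum, Finset.mul_sum, Finset.mul_sum, ← Finset.sum_add_distrib]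
    refine Finset.sum_le_sum fun i _ => ?_
    nlinarith [sq_nonneg (2 * (η i - θstar i) + 1 / 2 * (θ i - η i))]
  have h4 : ∑ i, (θ i - θstar i) ^ 2 ≤
      2 * ∑ i, (θ i - η i) ^ 2 + 2 * ∑ i, (η i - θstar i) ^ 2 := by
    rw [Finset.mul_sum, Finset.mul_sum, ← Finset.sum_add_distrib]
    refine Finset.sum_le_sum fun i _ => ?_
    nlinarith [sq_nonneg ((θ i - η i) - (η i - θstar i))]
  linarith

/-- The number of dyadic scales in a partition of `n` points into `k` blocks. -/
theorem sum_log_blocks_le {n k : ℕ} (hk : 1 ≤ k) (hkn : k ≤ n) {b : ℕ → ℕ} (hb0 : b 0 = 0)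
    (hb : Monotone b) (hbk : b k = n) :
    ∑ l ∈ Finset.range k, ((Nat.log 2 (b (l + 1) - b l) + 1 : ℕ) : ℝ) ≤
      2 * k * Real.log (16 * n / k) := by
  have hk0 : (0 : ℝ) < k := by exact_mod_cast hk
  have hn0 : (0 : ℝ) < n := by exact_mod_cast (by omega : 0 < n)
  have hnk : (1 : ℝ) ≤ n / k := by rw [one_le_div hk0]; exact_mod_cast hkn
  have hlog2 : 1 / 2 < Real.log 2 := by linarith [Real.log_two_gt_d9]
  have hlnk : 0 ≤ Real.log (n / k) := Real.log_nonneg hnk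
  -- The tangent line of the logarithm at the mean block length `n / k` stands in for Jensen's
  -- inequality; the factor 2 is from `log 2 > 1 / 2`.
  have hterm : ∀ m : ℕ, ((Nat.log 2 m + 1 : ℕ) : ℝ) ≤ 2 * (m * (k / n)) + 2 * Real.log (n / k) + 1 := by
    intro m
    rcases Nat.eq_zero_or_pos m with rfl | hm
    · simp; linarith
    have hm0 : (0 : ℝ) < m := by exact_mod_cast hm
    have h1 : (2 : ℝ) ^ Nat.log 2 m ≤ m := by exact_mod_cast Nat.pow_log_le_self 2 hm.ne'
    have h2 := Real.log_le_log (by positivity) h1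
    rw [Real.log_pow] at h2
    have h3 := Real.log_le_sub_one_of_pos (show 0 < (m : ℝ) * (k / n) by positivity)
    have h4 : Real.log (m * (k / n)) = Real.log m - Real.log (n / k) := by
      rw [Real.log_mul hm0.ne' (by positivity), Real.log_div hk0.ne' hn0.ne',
        Real.log_div hn0.ne' hk0.ne']
      ring
    push_cast
    have h5 : (0 : ℝ) ≤ Nat.log 2 m := Nat.cast_nonneg _
    nlinarith
  have hsum : ∑ l ∈ Finset.range k, ((b (l + 1) - b l : ℕ) : ℝ) = n := by
    have := sum_blocks hb0 hb (fun _ => (1 : ℝ)) k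
    simpa [hbk] using this
  refine (Finset.sum_le_sum fun l _ => hterm _).trans ?_
  simp only [Finset.sum_add_distrib, ← Finset.mul_sum, ← Finset.sum_mul, hsum, Finset.sum_const,
    Finset.card_range, nsmul_eq_mul, mul_one]
  have h16 : Real.log (16 * n / k) = 4 * Real.log 2 + Real.log (n / k) := by
    rw [mul_div_assoc, Real.log_mul (by norm_num) (by positivity),
      show (16 : ℝ) = 2 ^ 4 by norm_num, Real.log_pow]
    norm_num
  rw [h16, mul_div_cancel₀ _ hn0.ne']
  nlinarith

/-- The 16 matters here: `log 16 = 4 log 2` exceeds `e`. This is what makes `τ ≥ 1`. -/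
theorem one_le_log_log {n k : ℕ} (hk : 1 ≤ k) (hkn : k ≤ n) :
    1 ≤ Real.log (Real.log (16 * n / k)) ∧ 0 < Real.log (16 * n / k) := by
  have hk0 : (0 : ℝ) < k := by exact_mod_cast hk
  have hnk : (16 : ℝ) ≤ 16 * n / k := by
    rw [le_div_iff₀ hk0]
    have : (k : ℝ) ≤ n := by exact_mod_cast hkn
    linarith
  have h1 : Real.exp 1 ≤ Real.log (16 * n / k) := by
    refine le_trans ?_ (Real.log_le_log (by norm_num) hnk)
    rw [show (16 : ℝ) = 2 ^ 4 by norm_num, Real.log_pow]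
    push_cast
    linarith [Real.exp_one_lt_d9, Real.log_two_gt_d9]
  have h2 : 0 < Real.log (16 * n / k) := (Real.exp_pos 1).trans_le h1
  exact ⟨(Real.le_log_iff_exp_le h2).mpr h1, h2⟩

/-- Only the majorant `G` needs to be integrable. The loss `f` need not be measurable, which permits
an arbitrary selection of minimizers. -/
theorem lintegral_norm_sub_sq_le {Ω : Type*} [MeasurableSpace Ω] {μ : Measure Ω}
    [IsProbabilityMeasure μ] {f G : Ω → ℝ} {I E : ℝ} (hf : ∀ ω, 0 ≤ f ω) (hG : Integrable G μ)
    (hE : ∫ ω, G ω ∂μ ≤ E) (h : ∀ᵐ ω ∂μ, f ω ≤ 18 * I + 4 * G ω) :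
    ∫⁻ ω, ENNReal.ofReal (f ω) ∂μ ≤ ENNReal.ofReal (18 * I + 4 * E) := by
  have hi : Integrable (fun ω => 18 * I + 4 * G ω) μ := (integrable_const _).add (hG.const_mul 4)
  calc ∫⁻ ω, ENNReal.ofReal (f ω) ∂μ
      ≤ ∫⁻ ω, ENNReal.ofReal (18 * I + 4 * G ω) ∂μ :=
        lintegral_mono_ae (h.mono fun ω hω => ENNReal.ofReal_le_ofReal hω)
    _ = ENNReal.ofReal (∫ ω, (18 * I + 4 * G ω) ∂μ) :=
        (ofReal_integral_eq_lintegral_ofReal hi (h.mono fun ω hω => (hf ω).trans hω)).symm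
    _ ≤ ENNReal.ofReal (18 * I + 4 * E) := by
        refine ENNReal.ofReal_le_ofReal ?_
        rw [integral_add (integrable_const _) (hG.const_mul 4), integral_const_mul 4 G]
        simp only [integral_const, probReal_univ, one_smul]
        linarith

/-- A single constant piece is fitted at the parametric rate. -/
theorem exists_integrable_bound_one {Ω : Type*} [MeasurableSpace Ω] {μ : Measure Ω}
    [IsProbabilityMeasure μ] {n : ℕ} {V σ : ℝ} (hn : 0 < n) (hσ : 0 < σ) {Y : ℤ → Ω → ℝ}
    (hind : iIndepFun Y μ) (h0 : ∀ i, ∫ ω, Y i ω ∂μ = 0)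
    (hL : ∀ i, MemLp (Y i) 2 μ) (hV : ∀ i, ∫ ω, Y i ω ^ 2 ∂μ ≤ V)
    {η : EuclideanSpace ℝ (Fin n)} (hη : η ∈ isotonicPieces n 1) :
    ∃ G : Ω → ℝ, Integrable G μ ∧ ∫ ω, G ω ∂μ ≤ 4 * σ ^ 2 * V ∧
      ∀ ω, ∀ θ ∈ isotonicPieces n 1, 2 * ∑ i : Fin n, (σ * Y (i : ℕ) ω) * (θ i - η i) ≤
        G ω + 1 / 4 * ∑ i : Fin n, (θ i - η i) ^ 2 := by
  have hn0 : (0 : ℝ) < n := by exact_mod_cast hn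
  have hconst : ∀ θ ∈ isotonicPieces n 1, ∀ i, θ i = θ ⟨0, hn⟩ := by
    intro θ hθ i
    obtain ⟨-, b, hb0, -, hb1, hc⟩ := exists_breakpoints hn hθ
    exact hc 0 (by norm_num) _ _ (by omega) (by rw [zero_add, hb1]; exact i.2)
      (by simp [hb0]) (by rw [zero_add, hb1]; exact hn)
  have hnind : iIndepFun (fun i : ℕ => Y i) μ := hind.precomp (g := fun i : ℕ => (i : ℤ)) Nat.cast_injective
  have hvar := integral_sq_sum_range hnind (fun i => h0 i) (fun i => hL i) n
  have hSL : MemLp (fun ω => ∑ i ∈ Finset.range n, Y i ω) 2 μ := memLp_finsetSum _ fun i _ => hL i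
  refine ⟨fun ω => 4 * σ ^ 2 / n * (∑ i ∈ Finset.range n, Y i ω) ^ 2, hSL.integrable_sq.const_mul _,
    ?_, ?_⟩
  · rw [integral_const_mul, hvar]
    have h1 : ∑ i ∈ Finset.range n, ∫ ω, Y i ω ^ 2 ∂μ ≤ n * V := by
      refine (Finset.sum_le_sum fun (i : ℕ) _ => hV i).trans ?_
      simp
    refine (mul_le_mul_of_nonneg_left h1 (by positivity)).trans (le_of_eq ?_)
    field_simp
  · intro ω θ hθ
    have h1 : ∀ i, θ i - η i = θ ⟨0, hn⟩ - η ⟨0, hn⟩ := fun i => by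
      rw [hconst θ hθ i, hconst η hη i]
    simp only [h1]
    set c := θ ⟨0, hn⟩ - η ⟨0, hn⟩
    rw [← Finset.sum_mul, ← Finset.mul_sum, ← Finset.sum_range (fun i : ℕ => Y i ω)]
    set S := ∑ i ∈ Finset.range n, Y i ω
    simp only [Finset.sum_const, Finset.card_univ, Fintype.card_fin, nsmul_eq_mul]
    -- Both fits are constant, so the claim is a completed square in the single difference `c`.
    have h2 : 4 * σ ^ 2 / n * S ^ 2 + 1 / 4 * (n * c ^ 2) - 2 * (σ * S * c) =
        1 / (4 * n) * (4 * σ * S - n * c) ^ 2 := by field_simp; ring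
    have h3 : 0 ≤ 1 / (4 * n) * (4 * σ * S - n * c) ^ 2 := by positivity
    linarith

/-- The noise term of a `k`-piece fit is bounded at the iterated logarithmic rate. -/
theorem exists_integrable_bound {Ω : Type*} [MeasurableSpace Ω] {μ : Measure Ω}
    [IsProbabilityMeasure μ] {n k : ℕ} {V K σ : ℝ} (hk : 1 ≤ k) (hkn : k ≤ n)
    {Y : ℤ → Ω → ℝ} (hY : ∀ i, Measurable (Y i))
    (hind : iIndepFun Y μ) (h0 : ∀ i, ∫ ω, Y i ω ∂μ = 0)
    (hL : ∀ i, MemLp (Y i) 2 μ) (hV : ∀ i, ∫ ω, Y i ω ^ 2 ∂μ ≤ V)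
    (hK : ∀ τ : ℝ, 1 ≤ τ → ∀ (e : ℕ → ℤ) (N : ℕ), ∑ i ∈ Finset.range N,
      tailSecondMoment μ (Y (e i)) (((i : ℝ) + 1) / τ) / ((i : ℝ) + 1) ≤ K * τ)
    {η : EuclideanSpace ℝ (Fin n)} (hη : η ∈ isotonicPieces n k) :
    ∃ G : Ω → ℝ, Integrable G μ ∧
      ∫ ω, G ω ∂μ ≤ (768 * (V / 2 + 2) ^ 2 + 65536 + 512 * K) *
        (σ ^ 2 * k * Real.log (Real.log (16 * n / k))) ∧
      ∀ ω, ∀ θ ∈ isotonicPieces n k, 2 * ∑ i : Fin n, (σ * Y (i : ℕ) ω) * (θ i - η i) ≤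
        G ω + 1 / 4 * ∑ i : Fin n, (θ i - η i) ^ 2 := by
  have hn : 0 < n := by omega
  obtain ⟨hτ, hlog⟩ := one_le_log_log hk hkn
  have hexp : Real.exp (-Real.log (Real.log (16 * n / k))) = (Real.log (16 * n / k))⁻¹ := by
    rw [Real.exp_neg, Real.exp_log hlog]
  -- With this `τ`, `exp (-τ)` cancels the factor `log (16 n / k)` in the number of scales.
  set τ := Real.log (Real.log (16 * n / k)) with hτdef
  obtain ⟨-, b, hb0, hb, hbk, hc⟩ := exists_breakpoints hn hη
  have hleft := fun l : ℕ => exists_dyadic_bound (Y := fun r : ℕ => Y (b l + r)) (fun r => hY _)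
    (hind.precomp (g := fun r : ℕ => (b l + r : ℤ)) (fun r r' h => by simpa using h))
    (fun r => h0 _) (fun r => hL _) (fun r => hV _) hτ
  -- The subtraction is in `ℤ`, so the reindexing is injective and independence survives.
  have hright := fun l : ℕ => exists_dyadic_bound (Y := fun r : ℕ => Y (b (l + 1) - 1 - r))
    (fun r => hY _)
    (hind.precomp (g := fun r : ℕ => (b (l + 1) - 1 - r : ℤ)) (fun r r' h => by simpa using h))
    (fun r => h0 _) (fun r => hL _) (fun r => hV _) hτ
  choose R hRi hR0 hRS hRI using hleft
  choose R' hRi' hR0' hRS' hRI' using hright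
  set T := 16 * (V / 2 + 2) ^ 2 * τ with hT
  have hT0 : 0 ≤ T := by positivity
  set m : ℕ → ℕ := fun l => Nat.log 2 (b (l + 1) - b l) + 1 with hm
  have hsumi : ∀ l, Integrable (fun ω => ∑ s ∈ Finset.range (m l), R l s ω +
      ∑ s ∈ Finset.range (m l), R' l s ω) μ := fun l =>
    (integrable_finsetSum _ fun s _ => hRi l s).add (integrable_finsetSum _ fun s _ => hRi' l s)
  refine ⟨fun ω => σ ^ 2 * (48 * k * T + 8 * ∑ l ∈ Finset.range k,
    (∑ s ∈ Finset.range (m l), R l s ω + ∑ s ∈ Finset.range (m l), R' l s ω)), ?_, ?_, ?_⟩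
  · exact ((integrable_const _).add ((integrable_finsetSum _ fun l _ => hsumi l).const_mul 8)).const_mul _
  · rw [integral_const_mul, integral_add (integrable_const _)
      ((integrable_finsetSum _ fun l _ => hsumi l).const_mul 8), integral_const_mul (8 : ℝ),
      integral_finsetSum _ fun l _ => hsumi l]
    simp only [integral_const, probReal_univ, one_smul]
    have h1 : ∀ l, ∫ ω, (∑ s ∈ Finset.range (m l), R l s ω +
        ∑ s ∈ Finset.range (m l), R' l s ω) ∂μ ≤
        4096 * Real.exp (-τ) * m l + 64 * (K * τ) := by
      intro l
      rw [integral_add (integrable_finsetSum _ fun s _ => hRi l s)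
        (integrable_finsetSum _ fun s _ => hRi' l s), integral_finsetSum _ fun s _ => hRi l s,
        integral_finsetSum _ fun s _ => hRi' l s]
      have a1 := hRI l (m l)
      have a2 := hRI' l (m l)
      have a3 := hK τ hτ (fun r : ℕ => (b l + r : ℤ)) (2 ^ m l)
      have a4 := hK τ hτ (fun r : ℕ => (b (l + 1) - 1 - r : ℤ)) (2 ^ m l)
      linarith
    have h2 := Finset.sum_le_sum fun l (_ : l ∈ Finset.range k) => h1 l
    rw [Finset.sum_add_distrib, ← Finset.mul_sum] at h2
    simp only [Finset.sum_const, Finset.card_range, nsmul_eq_mul] at h2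
    have h3 := sum_log_blocks_le hk hkn hb0 hb hbk
    have h4 : 4096 * Real.exp (-τ) * ∑ l ∈ Finset.range k, (m l : ℝ) ≤ 8192 * k := by
      refine (mul_le_mul_of_nonneg_left h3 (by positivity)).trans (le_of_eq ?_)
      rw [hexp]
      field_simp
      norm_num
    have h5 : (k : ℝ) ≤ k * τ := le_mul_of_one_le_right (Nat.cast_nonneg _) hτ
    -- The constants are `48 * 16 = 768`, `8 * 8192 = 65536` and `8 * 64 = 512`.
    have h6 : 48 * k * T + 8 * ∑ l ∈ Finset.range k, ∫ ω, (∑ s ∈ Finset.range (m l), R l s ω +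
        ∑ s ∈ Finset.range (m l), R' l s ω) ∂μ ≤
        (768 * (V / 2 + 2) ^ 2 + 65536 + 512 * K) * (k * τ) := by
      rw [hT]
      linarith
    refine (mul_le_mul_of_nonneg_left h6 (sq_nonneg σ)).trans (le_of_eq ?_)
    ring
  · intro ω θ hθ
    have hscale : ∀ (S x : ℝ) (s : ℕ), S ^ 2 ≤ (T + x) * 2 ^ s →
        (σ * S) ^ 2 ≤ (σ ^ 2 * T + σ ^ 2 * x) * 2 ^ s := by
      intro S x s h
      have := mul_le_mul_of_nonneg_left h (sq_nonneg σ)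
      nlinarith
    have h1 := two_mul_sum_noise_le hn hk hθ hb0 hb hbk hc (z := fun i => σ * Y i ω)
      (T := σ ^ 2 * T) (by positivity)
      (R := fun l s => σ ^ 2 * R l s ω) (R' := fun l s => σ ^ 2 * R' l s ω)
      (fun l s => mul_nonneg (sq_nonneg σ) (hR0 l s ω))
      (fun l s => mul_nonneg (sq_nonneg σ) (hR0' l s ω))
      (fun l r => by rw [← Finset.mul_sum]; exact hscale _ _ _ (hRS l ω r))
      (fun l r => by rw [← Finset.mul_sum]; exact hscale _ _ _ (hRS' l ω r))
    simp only [← Finset.mul_sum, ← mul_add] at h1 ⊢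
    linarith

/-! ### The risk bound. -/

theorem theorem2p1 (ε C₁ : ℝ) (hε : ε ∈ Set.Ioo (0 : ℝ) 1) (hC₁ : 0 < C₁) :
    ∃ C : ℝ, 0 < C ∧
      ∀ (n k : ℕ), 1 ≤ k → k ≤ n →
      ∀ (σ : ℝ), 0 < σ →
      ∀ (θstar : EuclideanSpace ℝ (Fin n))
        (Ω : Type*) [MeasurableSpace Ω] (μ : Measure Ω) [IsProbabilityMeasure μ]
        (Z : Fin n → Ω → ℝ) (X θhat : Ω → EuclideanSpace ℝ (Fin n)),
        (∀ i, Measurable (Z i)) →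
        iIndepFun Z μ →
        (∀ i, ∫ ω, Z i ω ∂μ = 0) →
        ErrorMomentCondition μ ε C₁ σ Z →
        (∀ ω i, X ω i = θstar i + Z i ω) →
        (∀ᵐ ω ∂μ, IsReducedIsotonicLSE k (X ω) (θhat ω)) →
        ∫⁻ ω, ENNReal.ofReal (‖θhat ω - θstar‖ ^ 2) ∂μ ≤
          ENNReal.ofReal (C * ((⨅ θ : isotonicPieces n k, ‖(θ : EuclideanSpace ℝ (Fin n)) - θstar‖ ^ 2)
            + σ ^ 2
            + if 2 ≤ k then σ ^ 2 * k * Real.log (Real.log (16 * n / k)) else 0)) := by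

  have hC₁' := hC₁.le
  have hK0 := tailConstant_nonneg (ε := ε) hC₁'
  set K := tailConstant ε C₁ with hKdef
  set V := 1 + C₁ with hVdef
  set B := 768 * (V / 2 + 2) ^ 2 + 65536 + 512 * K with hB
  have hB0 : 0 ≤ B := by positivity
  -- The basic inequality contributes 18 for the approximation error and a factor 4 on the noise: `4
  -- * 4 * V` for one piece, `4 * B` for several.
  refine ⟨18 + 16 * V + 4 * B, by positivity, ?_⟩
  intro n k hk hkn σ hσ θstar Ω _ μ _ Z X θhat hZm hZi hZ0 hmom hX hLSE
  have hn : 0 < n := by omega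
  obtain ⟨hmom2, htail⟩ := hmom.bounds hε hC₁' hZm
  set W : Fin n → Ω → ℝ := fun i ω => Z i ω / σ with hW
  set Y : ℤ → Ω → ℝ := zeroExtend W with hYdef
  have hWm : ∀ i, Measurable (W i) := fun i => (hZm i).div_const σ
  have hWi : iIndepFun W μ := hZi.comp (fun _ x => x / σ) fun _ => measurable_id.div_const σ
  have hYi : iIndepFun Y μ := iIndepFun_zeroExtend hWi
  have hYm : ∀ i, Measurable (Y i) := fun i => by
    rcases zeroExtend_eq_or W i with ⟨j, hj⟩ | hj <;> rw [hYdef, hj]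
    · exact hWm j
    · exact measurable_const
  have hY0 : ∀ i, ∫ ω, Y i ω ∂μ = 0 := fun i => by
    rcases zeroExtend_eq_or W i with ⟨j, hj⟩ | hj <;> rw [hYdef, hj]
    · simp only [hW]
      rw [integral_div, hZ0 j, zero_div]
    · simp
  have hYL : ∀ i, MemLp (Y i) 2 μ := fun i => by
    rcases zeroExtend_eq_or W i with ⟨j, hj⟩ | hj <;> rw [hYdef, hj]
    · exact (memLp_two_iff_integrable_sq (hWm j).aestronglyMeasurable).mpr (hmom2 j).1
    · exact MemLp.zero
  have hYV : ∀ i, ∫ ω, Y i ω ^ 2 ∂μ ≤ V := fun i => by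
    rcases zeroExtend_eq_or W i with ⟨j, hj⟩ | hj <;> rw [hYdef, hj]
    · exact (hmom2 j).2
    · simp; positivity
  have hYK : ∀ τ : ℝ, 1 ≤ τ → ∀ (e : ℕ → ℤ) (N : ℕ), ∑ i ∈ Finset.range N,
      tailSecondMoment μ (Y (e i)) (((i : ℝ) + 1) / τ) / ((i : ℝ) + 1) ≤ K * τ := by
    intro τ hτ e N
    have h1 : ∀ i : ℕ, ∃ j : Fin n, ∀ u, 0 ≤ u →
        tailSecondMoment μ (Y (e i)) u ≤ tailSecondMoment μ (W j) u := by
      intro i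
      rcases zeroExtend_eq_or W (e i) with ⟨j, hj⟩ | hj
      · exact ⟨j, fun u _ => by rw [hYdef, hj]⟩
      · refine ⟨⟨0, hn⟩, fun u hu => ?_⟩
        rw [hYdef, hj]
        refine le_trans (le_of_eq ?_) (tailSecondMoment_nonneg _ _)
        simp [tailSecondMoment]
    choose j hj using h1
    refine (Finset.sum_le_sum fun i _ => ?_).trans (htail τ hτ j N)
    exact div_le_div_of_nonneg_right (hj i _ (by positivity)) (by positivity)
  -- The oracle is the least-squares fit to `θstar` itself, so the infimum is attained.
  obtain ⟨η, hη, hηmin⟩ := exists_isReducedIsotonicLSE hk hkn θstar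
  have hI : ‖η - θstar‖ ^ 2 ≤
      ⨅ θ : isotonicPieces n k, ‖(θ : EuclideanSpace ℝ (Fin n)) - θstar‖ ^ 2 := by
    have : Nonempty (isotonicPieces n k) := ⟨⟨η, hη⟩⟩
    refine le_ciInf fun θ => ?_
    rw [norm_sub_rev, norm_sub_rev _ θstar]
    exact hηmin θ θ.2
  set I := ⨅ θ : isotonicPieces n k, ‖(θ : EuclideanSpace ℝ (Fin n)) - θstar‖ ^ 2
  have hI0 : 0 ≤ I := (sq_nonneg _).trans hI
  have hnoise : ∀ ω (i : Fin n), X ω i - θstar i = σ * Y (i : ℕ) ω := fun ω i => by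
    rw [hX, hYdef, zeroExtend_natCast]
    simp only [hW]
    field_simp
    ring
  have hmain : ∀ (G : Ω → ℝ) (E : ℝ), Integrable G μ → ∫ ω, G ω ∂μ ≤ E →
      (∀ ω, ∀ θ ∈ isotonicPieces n k, 2 * ∑ i : Fin n, (σ * Y (i : ℕ) ω) * (θ i - η i) ≤
        G ω + 1 / 4 * ∑ i : Fin n, (θ i - η i) ^ 2) →
      ∫⁻ ω, ENNReal.ofReal (‖θhat ω - θstar‖ ^ 2) ∂μ ≤ ENNReal.ofReal (18 * I + 4 * E) := by
    intro G E hGi hGE hG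
    refine lintegral_norm_sub_sq_le (fun ω => sq_nonneg _) hGi hGE ?_
    filter_upwards [hLSE] with ω hω
    refine (hω.norm_sub_sq_le hη (G := G ω) (θstar := θstar) ?_).trans (by linarith)
    simp only [hnoise]
    exact hG ω _ hω.1
  have hV0 : 0 ≤ V := by positivity
  split_ifs with hk2
  · obtain ⟨G, hGi, hGE, hG⟩ := exists_integrable_bound (σ := σ) hk hkn hYm hYi hY0 hYL hYV hYK hη
    rw [← hB] at hGE
    refine (hmain G _ hGi hGE hG).trans (ENNReal.ofReal_le_ofReal ?_)
    have hτ := (one_le_log_log hk hkn).1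
    have h1 : 0 ≤ σ ^ 2 * k * Real.log (Real.log (16 * n / k)) := by positivity
    set Q := σ ^ 2 * k * Real.log (Real.log (16 * n / k))
    have h2 : 0 ≤ 16 * V * (I + σ ^ 2 + Q) := by positivity
    have h3 : 0 ≤ 4 * B * (I + σ ^ 2) := by positivity
    have h4 : 0 ≤ 18 * (σ ^ 2 + Q) := by positivity
    linarith
  · obtain rfl : k = 1 := by omega
    obtain ⟨G, hGi, hGE, hG⟩ := exists_integrable_bound_one (σ := σ) hn hσ hYi hY0 hYL hYV hη
    refine (hmain G _ hGi hGE hG).trans (ENNReal.ofReal_le_ofReal ?_)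
    have h2 : 0 ≤ 16 * V * I := by positivity
    have h3 : 0 ≤ 4 * B * (I + σ ^ 2) := by positivity
    have h4 : 0 ≤ 18 * σ ^ 2 := by positivity
    linarith
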